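/- Let $n\in\mathbb N$, $d\in\mathbb R$ and $\theta\in\mathbb R^n$ with $|\theta|=1$. Write $\hat u(\xi)=\int e^{-ix\cdot\xi}u(x)\,dx$. Let $v\in\mathcal S(\mathbb R^n)$, $v\neq0$, have $\operatorname{supp}\hat v$ contained in the closed ball of radius $1/20$ around $0$, and for $\theta'\in\mathbb R^n$ with $|\theta'|=1$ and $d'\in\mathbb R$ put $$w(\theta',d';x)=\sum_{j=1}^\infty 2^{-jd'}e^{i2^j\theta'\cdot x}v(x)\qquad\text{(convergence in }\mathcal S'(\mathbb R^n)).$$ Let $A\in C_0^\infty(\mathbb R^n)$ be such that $A(\eta)\ne0$ only holds for $\tfrac34\le|\eta|\le\tfrac54$, and $A(\eta)=1$ for $\tfrac9{10}\le|\eta|\le\tfrac{11}{10}$, and let $$a_{2\theta}(x,\eta)=\sum_{j=0}^\infty 2^{jd}e^{-i2^j(2\theta)\cdot x}A(2^{-j}\eta).$$ A symbol $a$ belongs to $S^d_{1,1}$ if $a\in C^\infty(\mathbb R^n\times\mathbb R^n)$ and $|\partial_\eta^\alpha\partial_x^\beta a(x,\eta)|\le C_{\alpha,\beta}(1+|\eta|)^{d-|\alpha|+|\beta|}$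 for all multi-indices $\alpha,\beta$ and all $x,\eta$. Its operator $a(x,D)$ is defined by vanishing frequency modulation: for $\psi\in C_0^\infty(\mathbb R^n)$ equal to $1$ near $0$ let $a^m(x,\eta)=\mathcal F^{-1}_{\xi\to x}[\psi(2^{-m}\xi)\mathcal F_{x\to\xi}a(\xi,\eta)]$; a distribution $u\in\mathcal S'(\mathbb R^n)$ is in the domain $D(a(x,D))$ if $\lim_{m\to\infty}\operatorname{OP}(a^m(x,\eta)\psi(2^{-m}\eta))u$ exists in $\mathcal D'(\mathbb R^n)$ for every such $\psi$ and is independent of $\psi$, and then $a(x,D)u$ is this limit. Here $\operatorname{OP}(b)u(x)=(2\pi)^{-n}\int e^{ix\cdot\eta}b(x,\eta)\hat u(\eta)\,d\eta$, extended to $u\in\mathcal S'(\mathbb R^n)$ for $b\in S^{-\infty}$. The wavefront set $\operatorname{WF}(u)$ is the complement of those $(x,\xi)\in\mathbb R^n\times(\mathbb R^n\setminus\{0\})$ for which $\mathcal F(\varphi u)$ decays rapidly in a conical neighbourhood of $\xi$ for some $\varphi\in C_0^\infty(\mathbb R^n)$ with $\varphi(x)\neq0$. Then the series for $w(\theta,d;\cdot)$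 converges in $\mathcal S'(\mathbb R^n)$, and for $s\in\mathbb R$, $$w(\theta,d;\cdot)\in H^s(\mathbb R^n)\iff s<d .$$ Moreover, $a_{2\theta}\in S^d_{1,1}(\mathbb R^n\times\mathbb R^n)$, the distribution $w(\theta,d;\cdot)$ belongs to $D(a_{2\theta}(x,D))$, and $$a_{2\theta}(x,D)w(\theta,d;x)=w(-\theta,0;x).$$ Finally, with $\mathbb R_+=\,]0,\infty[$, $$\operatorname{WF}(w(\theta,d;\cdot))=\mathbb R^n\times(\mathbb R_+\theta),\qquad \operatorname{WF}(a_{2\theta}(x,D)w(\theta,d;\cdot))=\mathbb R^n\times(\mathbb R_+(-\theta)),$$ so the wavefront sets of $w(\theta,d;\cdot)$ and $a_{2\theta}(x,D)w(\theta,d;\cdot)$ are disjoint. -/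

import Mathlib

open MeasureTheory Filter Topology SchwartzMap TemperedDistribution Distributions
open scoped ContDiff RealInnerProductSpace

noncomputable section

/-! ### Test functions, distributions and the Fourier transformation -/

/-- Euclidean space `ℝⁿ`. -/
abbrev Rn (n : ℕ) : Type := EuclideanSpace ℝ (Fin n)

/-- `C₀^∞(ℝⁿ)`, complex valued, with its usual LF topology. -/
abbrev TestFn (n : ℕ) : Type := 𝓓((⊤ : TopologicalSpace.Opens (Rn n)), ℂ)

/-- `𝓓'(ℝⁿ)`, the continuous complex linear functionals on `C₀^∞(ℝⁿ)`. -/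
abbrev Distr (n : ℕ) : Type := TestFn n →L[ℂ] ℂ

namespace TestFn

variable {n : ℕ}

/-- The continuous inclusion `C₀^∞(ℝⁿ) ⊂ 𝓢(ℝⁿ)`. -/
def toSchwartz : TestFn n →L[ℂ] 𝓢(Rn n, ℂ) :=
  TestFunction.mkCLM ℂ (fun φ => φ.hasCompactSupport.toSchwartzMap φ.contDiff)
    (fun _ _ => rfl) (fun _ _ => rfl) <| by
  intro K hK
  let Φ : ContDiffMapSupportedIn (Rn n) ℂ ⊤ K →ₗ[ℂ] 𝓢(Rn n, ℂ) :=
    { toFun := fun f => f.hasCompactSupport.toSchwartzMap f.contDiff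
      map_add' := fun _ _ => rfl
      map_smul' := fun _ _ => rfl }
  change Continuous Φ
  refine WithSeminorms.continuous_of_isBounded
    (ContDiffMapSupportedIn.withSeminorms ℂ (Rn n) ℂ ⊤ K)
    (schwartz_withSeminorms ℂ (Rn n) ℂ) Φ (.of_real fun i => ?_)
  obtain ⟨R, hR⟩ := K.isCompact.isBounded.exists_norm_le
  refine ⟨{i.2}, (max R 0) ^ i.1, fun f => ?_⟩
  have h0 : 0 ≤ ContDiffMapSupportedIn.seminorm ℂ (Rn n) ℂ ⊤ K i.2 f := apply_nonneg _ _
  have hb : 0 ≤ (max R 0) ^ i.1 * ContDiffMapSupportedIn.seminorm ℂ (Rn n) ℂ ⊤ K i.2 f := by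
    positivity
  simp only [Finset.sup_singleton]
  refine SchwartzMap.seminorm_le_bound ℂ i.1 i.2 _ hb fun x => ?_
  change ‖x‖ ^ i.1 * ‖iteratedFDeriv ℝ i.2 f x‖ ≤ _
  by_cases hx : x ∈ (K : Set (Rn n))
  · have h1 : ‖x‖ ≤ max R 0 := (hR x hx).trans (le_max_left _ _)
    have h2 : ‖iteratedFDeriv ℝ i.2 f x‖ ≤
        ContDiffMapSupportedIn.seminorm ℂ (Rn n) ℂ ⊤ K i.2 f :=
      ContDiffMapSupportedIn.norm_iteratedFDeriv_apply_le_seminorm_top ℂ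
    gcongr
  · have hs : tsupport (f : Rn n → ℂ) ⊆ K :=
      closure_minimal (Function.support_subset_iff'.2 f.zero_on_compl) K.isCompact.isClosed
    have h3 : iteratedFDeriv ℝ i.2 f x = 0 := by
      by_contra h
      exact hx (hs (support_iteratedFDeriv_subset i.2 h))
    rw [h3, norm_zero, mul_zero]
    exact hb

@[simp] theorem toSchwartz_apply (φ : TestFn n) (x : Rn n) : toSchwartz φ x = φ x := rfl

/-- Multiplication of a test function by a smooth function. -/
def mulSmooth (φ : TestFn n) (f : Rn n → ℂ) (hf : ContDiff ℝ ∞ f) : TestFn n where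
  toFun x := φ x * f x
  contDiff' := φ.contDiff.mul hf
  hasCompactSupport' := φ.hasCompactSupport.mul_right
  tsupport_subset' := fun _ _ => trivial

@[simp] theorem mulSmooth_apply (φ : TestFn n) (f : Rn n → ℂ) (hf : ContDiff ℝ ∞ f) (x : Rn n) :
    mulSmooth φ f hf x = φ x * f x := rfl

/-- The dilated test function `ξ ↦ φ(2^{-m} ξ)`. -/
def dilate (φ : TestFn n) (m : ℕ) : TestFn n where
  toFun ξ := φ (((2 : ℝ) ^ m)⁻¹ • ξ)
  contDiff' := φ.contDiff.comp (contDiff_const_smul _)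
  hasCompactSupport' := φ.hasCompactSupport.comp_smul (by positivity)
  tsupport_subset' := fun _ _ => trivial

@[simp] theorem dilate_apply (φ : TestFn n) (m : ℕ) (ξ : Rn n) :
    dilate φ m ξ = φ (((2 : ℝ) ^ m)⁻¹ • ξ) := rfl

end TestFn

variable {n : ℕ}

/-- The restriction of a tempered distribution to `C₀^∞(ℝⁿ)`, that is `𝓢' ⊂ 𝓓'`. -/
def toDistr (u : 𝓢'(Rn n, ℂ)) : Distr n where
  toFun φ := u (TestFn.toSchwartz φ)
  map_add' φ ψ := by simp
  map_smul' c φ := by simp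
  cont := u.continuous.comp TestFn.toSchwartz.continuous

@[simp] theorem toDistr_apply (u : 𝓢'(Rn n, ℂ)) (φ : TestFn n) :
    toDistr u φ = u (TestFn.toSchwartz φ) := rfl

/-- The exponential function `x ↦ e^{i x·ξ}`. -/
def expi (ξ x : Rn n) : ℂ := Complex.exp (Complex.I * (⟪x, ξ⟫ : ℝ))

theorem contDiff_expi (ξ : Rn n) : ContDiff ℝ ∞ (expi ξ) := by
  unfold expi
  have h : ContDiff ℝ ∞ fun x : Rn n => ((⟪x, ξ⟫ : ℝ) : ℂ) :=
    Complex.ofRealCLM.contDiff.comp (contDiff_id.inner ℝ contDiff_const)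
  exact Complex.contDiff_exp.comp (contDiff_const.mul h)

theorem hasTemperateGrowth_expi (ξ : Rn n) : (expi ξ).HasTemperateGrowth := by
  have key : (fun t : ℝ => Complex.exp (Complex.I * t)).HasTemperateGrowth := by
    have hs : ContDiff ℝ ∞ (fun t : ℝ => Complex.exp (Complex.I * t)) :=
      Complex.contDiff_exp.comp (contDiff_const.mul Complex.ofRealCLM.contDiff)
    have hd : ∀ k : ℕ, iteratedDeriv k (fun t : ℝ => Complex.exp (Complex.I * t)) =
        fun t : ℝ => Complex.I ^ k * Complex.exp (Complex.I * t) := by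
      intro k
      induction k with
      | zero => simp
      | succ k ih =>
        rw [iteratedDeriv_succ, ih]
        funext t
        have h1 : HasDerivAt (fun t : ℝ => Complex.I * (t : ℂ)) (Complex.I * 1) t :=
          (Complex.ofRealCLM.hasDerivAt).const_mul _
        have h2 := (h1.cexp).const_mul (Complex.I ^ k)
        rw [h2.deriv]
        ring
    refine ⟨hs, fun k => ⟨0, 1, fun t => ?_⟩⟩
    rw [norm_iteratedFDeriv_eq_norm_iteratedDeriv, hd]
    simp [mul_comm Complex.I, Complex.norm_exp_ofReal_mul_I]
  have h2 : (fun x : Rn n => ⟪x, ξ⟫).HasTemperateGrowth := by fun_prop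
  exact key.comp h2

/-- The Fourier transformation `f̂(ξ) = ∫ e^{-i x·ξ} f(x) dx` on `𝓢(ℝⁿ)`; see
`fourierS_apply` for the integral formula (Mathlib's `𝓕` has `e^{-2πi x·ξ}` instead). -/
def fourierS : 𝓢(Rn n, ℂ) →L[ℂ] 𝓢(Rn n, ℂ) :=
  (SchwartzMap.compCLMOfContinuousLinearEquiv ℂ
    (ContinuousLinearEquiv.smulLeft
      (Units.mk0 ((2 * Real.pi)⁻¹ : ℝ) (by positivity)) : Rn n ≃L[ℝ] Rn n)).comp
    (FourierTransform.fourierCLM ℂ 𝓢(Rn n, ℂ))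

theorem fourierS_apply (f : 𝓢(Rn n, ℂ)) (ξ : Rn n) :
    fourierS f ξ = ∫ x, expi ξ (-x) * f x := by
  change (FourierTransform.fourier f : 𝓢(Rn n, ℂ)) ((2 * Real.pi)⁻¹ • ξ) = _
  rw [SchwartzMap.fourier_coe, Real.fourier_eq']
  refine integral_congr_ae (.of_forall fun x => ?_)
  simp only [expi, smul_eq_mul]
  congr 2
  rw [inner_smul_right, inner_neg_left]
  push_cast
  have : (Real.pi : ℂ) ≠ 0 := by exact_mod_cast Real.pi_ne_zero
  field_simp

/-- The Fourier transformation on `𝓢'(ℝⁿ)`, `⟨û, g⟩ = ⟨u, ĝ⟩`. -/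
def fourierS' (u : 𝓢'(Rn n, ℂ)) : 𝓢'(Rn n, ℂ) :=
  PointwiseConvergenceCLM.precomp ℂ fourierS u

@[simp] theorem fourierS'_apply (u : 𝓢'(Rn n, ℂ)) (g : 𝓢(Rn n, ℂ)) :
    fourierS' u g = u (fourierS g) := rfl

/-! ### Wavefront sets -/

/-- For `φ ∈ C₀^∞` and `u ∈ 𝓓'`, the (smooth) Fourier transform of the compactly supported
distribution `φ u`, namely `ξ ↦ ⟨φ u, e^{-i x·ξ}⟩ = ⟨u, φ e^{-i x·ξ}⟩`. -/
def fourierLoc (u : Distr n) (φ : TestFn n) (ξ : Rn n) : ℂ :=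
  u (φ.mulSmooth (expi (-ξ)) (contDiff_expi _))

/-- `(x, ξ)` is a regular direction of `u`: for some `φ ∈ C₀^∞` with `φ(x) ≠ 0`, the Fourier
transform of `φ u` decays rapidly in an open conical neighbourhood of `ξ`. -/
def IsMicroRegular (u : Distr n) (x ξ : Rn n) : Prop :=
  ∃ φ : TestFn n, φ x ≠ 0 ∧ ∃ Γ : Set (Rn n), IsOpen Γ ∧ ξ ∈ Γ ∧
    (∀ t : ℝ, 0 < t → ∀ η ∈ Γ, t • η ∈ Γ) ∧
    ∀ N : ℕ, ∃ C : ℝ, ∀ η ∈ Γ, (1 + ‖η‖) ^ N * ‖fourierLoc u φ η‖ ≤ C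

/-- The wavefront set of `u ∈ 𝓓'(ℝⁿ)`, a subset of `ℝⁿ × (ℝⁿ ∖ {0})`. -/
def WF (u : Distr n) : Set (Rn n × Rn n) :=
  {p | p.2 ≠ 0 ∧ ¬ IsMicroRegular u p.1 p.2}

/-- The open half-line `ℝ₊ θ`. -/
def openRay (θ : Rn n) : Set (Rn n) := {ξ | ∃ t : ℝ, 0 < t ∧ ξ = t • θ}

/-! ### Symbols of type `1,1` and their operators -/

/-- The class `S^d_{1,1}(ℝⁿ × ℝⁿ)`: smooth functions `a(x, η)` such that
`|∂_η^α ∂_x^β a(x, η)| ≤ C_{α,β} (1 + |η|)^{d - |α| + |β|}` for all multi-indices. The partial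
derivatives with `|α| = k`, `|β| = l` are collected in the `k`-th Fréchet derivative in `η` of the
`l`-th Fréchet derivative in `x`. -/
structure IsSymbol11 (d : ℝ) (a : Rn n → Rn n → ℂ) : Prop where
  smooth : ContDiff ℝ ∞ fun p : Rn n × Rn n => a p.1 p.2
  bound : ∀ k l : ℕ, ∃ C : ℝ, ∀ x η : Rn n,
    ‖iteratedFDeriv ℝ k (fun η' => iteratedFDeriv ℝ l (fun x' => a x' η') x) η‖ ≤
      C * (1 + ‖η‖) ^ (d - k + l)

theorem IsSymbol11.hasTemperateGrowth {d : ℝ} {a : Rn n → Rn n → ℂ} (ha : IsSymbol11 d a)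
    (η : Rn n) : (fun x => a x η).HasTemperateGrowth := by
  refine ⟨ha.smooth.comp (contDiff_id.prodMk contDiff_const), fun l => ?_⟩
  obtain ⟨C, hC⟩ := ha.bound 0 l
  refine ⟨0, C * (1 + ‖η‖) ^ (d - (0 : ℕ) + l), fun x => ?_⟩
  have h := hC x η
  rw [norm_iteratedFDeriv_zero] at h
  simpa using h

/-- `a(·, η)` as an element of `𝓢'(ℝⁿ)`, for a fixed `η`. -/
def IsSymbol11.slice {d : ℝ} {a : Rn n → Rn n → ℂ} (ha : IsSymbol11 d a) (η : Rn n) :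
    𝓢'(Rn n, ℂ) :=
  (ha.hasTemperateGrowth η).toTemperedDistribution

/-- `U = OP(b) u` for a smoothing symbol `b` and `u ∈ 𝓢'`: as
`OP(b)u(x) = (2π)^{-n} ∫ e^{i x·η} b(x, η) û(η) dη`, this means that `⟨U, φ⟩ = ⟨û, g⟩` for all
`φ ∈ 𝓢`, where `g(η) = (2π)^{-n} ∫ e^{i x·η} b(x, η) φ(x) dx` is a Schwartz function. -/
def IsOP (b : Rn n → Rn n → ℂ) (u U : 𝓢'(Rn n, ℂ)) : Prop :=
  ∀ φ : 𝓢(Rn n, ℂ), ∃ g : 𝓢(Rn n, ℂ),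
    (∀ η, g η = ((2 * Real.pi : ℝ) : ℂ)⁻¹ ^ n * ∫ x, expi η x * b x η * φ x) ∧
    U φ = fourierS' u g

/-- A modulation function is a test function that equals `1` in a neighbourhood of `0`. -/
def IsModulation (ψ : TestFn n) : Prop := ∀ᶠ ξ in 𝓝 (0 : Rn n), ψ ξ = 1

/-- `a^m(x, η) = 𝓕⁻¹_{ξ → x} [ψ(2^{-m}ξ) â(ξ, η)]`, where `â(·, η) ∈ 𝓢'` is the Fourier
transform of `a(·, η)`. The inverse transform of this compactly supported distribution is the
function with value `(2π)^{-n} ⟨â(·, η), ψ(2^{-m}·) e^{i x·(·)}⟩` at `x`. -/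
def IsSymbol11.freqCut {d : ℝ} {a : Rn n → Rn n → ℂ} (ha : IsSymbol11 d a) (ψ : TestFn n)
    (m : ℕ) (x η : Rn n) : ℂ :=
  ((2 * Real.pi : ℝ) : ℂ)⁻¹ ^ n *
    fourierS' (ha.slice η) (TestFn.toSchwartz ((ψ.dilate m).mulSmooth (expi x) (contDiff_expi x)))

/-- For every modulation function `ψ`, the sequence `OP(a^m(x, η) ψ(2^{-m}η)) u` converges
to `T` in `𝓓'(ℝⁿ)` for `m → ∞`. -/
def IsSymbol11.IsLimit {d : ℝ} {a : Rn n → Rn n → ℂ} (ha : IsSymbol11 d a)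
    (u : 𝓢'(Rn n, ℂ)) (T : Distr n) : Prop :=
  ∀ ψ : TestFn n, IsModulation ψ → ∃ U : ℕ → 𝓢'(Rn n, ℂ),
    (∀ m, IsOP (fun x η => ha.freqCut ψ m x η * ψ (((2 : ℝ) ^ m)⁻¹ • η)) u (U m)) ∧
    ∀ φ : TestFn n, Tendsto (fun m => toDistr (U m) φ) atTop (𝓝 (T φ))

theorem exists_isModulation (n : ℕ) : ∃ ψ : TestFn n, IsModulation ψ := by
  let f : ContDiffBump (0 : Rn n) := ⟨1, 2, one_pos, one_lt_two⟩
  refine ⟨⟨fun x => ((f x : ℝ) : ℂ), Complex.ofRealCLM.contDiff.comp f.contDiff,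
    f.hasCompactSupport.comp_left Complex.ofReal_zero, fun _ _ => trivial⟩, ?_⟩
  filter_upwards [f.eventuallyEq_one] with x hx
  change ((f x : ℝ) : ℂ) = 1
  rw [hx]
  simp

theorem IsOP.unique {b : Rn n → Rn n → ℂ} {u U V : 𝓢'(Rn n, ℂ)} (hU : IsOP b u U)
    (hV : IsOP b u V) : U = V := by
  ext φ
  obtain ⟨g, hg, h1⟩ := hU φ
  obtain ⟨g', hg', h2⟩ := hV φ
  have : g = g' := by
    ext η
    rw [hg, hg']
  rw [h1, h2, this]

/-- The limit is unique, so that the operator below is well defined. -/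
theorem IsSymbol11.IsLimit.unique {d : ℝ} {a : Rn n → Rn n → ℂ} {ha : IsSymbol11 d a}
    {u : 𝓢'(Rn n, ℂ)} {T S : Distr n} (hT : ha.IsLimit u T) (hS : ha.IsLimit u S) : T = S := by
  obtain ⟨ψ, hψ⟩ := exists_isModulation n
  obtain ⟨U, hU, hUT⟩ := hT ψ hψ
  obtain ⟨V, hV, hVS⟩ := hS ψ hψ
  have hUV : U = V := funext fun m => (hU m).unique (hV m)
  subst hUV
  ext φ
  exact tendsto_nhds_unique (hUT φ) (hVS φ)

/-- The domain `D(a(x,D)) ⊂ 𝓢'(ℝⁿ)` of the type `1,1`-operator `a(x,D)`: the limits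
`lim_m OP(a^m(x, η) ψ(2^{-m}η)) u` exist in `𝓓'` and do not depend on `ψ`. -/
def IsSymbol11.domain {d : ℝ} {a : Rn n → Rn n → ℂ} (ha : IsSymbol11 d a) :
    Set 𝓢'(Rn n, ℂ) :=
  {u | ∃ T : Distr n, ha.IsLimit u T}

open Classical in
/-- The type `1,1`-operator `a(x,D) : D(a(x,D)) → 𝓓'(ℝⁿ)`, defined by vanishing frequency
modulation (and given the value `0` outside of its domain). -/
def IsSymbol11.op {d : ℝ} {a : Rn n → Rn n → ℂ} (ha : IsSymbol11 d a) (u : 𝓢'(Rn n, ℂ)) :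
    Distr n :=
  if h : ∃ T : Distr n, ha.IsLimit u T then h.choose else 0

theorem IsSymbol11.IsLimit.op_eq {d : ℝ} {a : Rn n → Rn n → ℂ} {ha : IsSymbol11 d a}
    {u : 𝓢'(Rn n, ℂ)} {T : Distr n} (hT : ha.IsLimit u T) : ha.op u = T := by
  have h : ∃ T : Distr n, ha.IsLimit u T := ⟨T, hT⟩
  rw [IsSymbol11.op, dif_pos h]
  exact h.choose_spec.unique hT

/-! ### Ching's symbol and the distributions `w(θ, d)` -/

/-- Ching's symbol `a_θ(x, η) = ∑_{j ≥ 0} 2^{jd} e^{-i 2^j θ·x} A(2^{-j}η)`. -/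
def chingSymbol (d : ℝ) (θ : Rn n) (A : Rn n → ℂ) (x η : Rn n) : ℂ :=
  ∑' j : ℕ, (((2 : ℝ) ^ ((j : ℝ) * d) : ℝ) : ℂ) *
    expi (-((2 : ℝ) ^ j • θ)) x * A (((2 : ℝ) ^ j)⁻¹ • η)

/-- The Schwartz function `2^{-jd} e^{i 2^j θ·x} v(x)`. -/
def wTerm (d : ℝ) (θ : Rn n) (v : 𝓢(Rn n, ℂ)) (j : ℕ) : 𝓢(Rn n, ℂ) :=
  (((2 : ℝ) ^ (-((j : ℝ) * d)) : ℝ) : ℂ) • SchwartzMap.smulLeftCLM ℂ (expi ((2 : ℝ) ^ j • θ)) v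

theorem wTerm_apply (d : ℝ) (θ : Rn n) (v : 𝓢(Rn n, ℂ)) (j : ℕ) (x : Rn n) :
    wTerm d θ v j x =
      (((2 : ℝ) ^ (-((j : ℝ) * d)) : ℝ) : ℂ) * (expi ((2 : ℝ) ^ j • θ) x * v x) := by
  simp [wTerm, SchwartzMap.smulLeftCLM_apply_apply (hasTemperateGrowth_expi _)]

/-- The terms with `j ≥ 1` as tempered distributions, indexed by `j - 1`. -/
def wTermDist (d : ℝ) (θ : Rn n) (v : 𝓢(Rn n, ℂ)) (j : ℕ) : 𝓢'(Rn n, ℂ) :=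
  toTemperedDistributionCLM (Rn n) ℂ volume (wTerm d θ v (j + 1))

/-- `w(θ, d) = ∑_{j ≥ 1} 2^{-jd} e^{i 2^j θ·x} v(x)`, with the series summed in `𝓢'(ℝⁿ)`. -/
def wDist (d : ℝ) (θ : Rn n) (v : 𝓢(Rn n, ℂ)) : 𝓢'(Rn n, ℂ) :=
  ∑' j : ℕ, wTermDist d θ v j

end

/-! On the Fourier side `w(θ,d)` is a sum of bumps `2^{-jd} v̂(· - 2^j θ)` of radius `1/20`, sitting
at dyadic points of the ray `ℝ₊θ`; their supports are disjoint.

Wavefront set: localizing by `φ` replaces `v̂` by the Schwartz function `F = (vφ)^`, so the question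
is how `∑ 2^{-jd} F(η - 2^j θ)` decays in cones. Off the ray, `|η - 2^j θ| ≳ |η| + 2^j`, and the sum
decays rapidly (`isMicroRegular_wDist`). Along the ray, evaluation at `ζ + 2^k θ` isolates `F(ζ)` up
to a rapidly small error, so rapid decay would force `F = 0` (`eq_zero_of_lacunary_decay`). Then `v`
vanishes wherever `φ ≠ 0`, and a band-limited function vanishing on an open set is zero
(`eq_zero_of_eventually_eq_zero`). Hence every `x` occurs.

Sobolev regularity: on the `j`-th bump the weight is comparable to `2^{js}`, so that term has `H^s`
norm of size `2^{j(s-d)}`. This is summable for `s < d`, while at `s = d` the terms are orthogonal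
and do not tend to zero (`memSobolev_wDist`, `not_memSobolev_wDist`).

Operator: `A(2^{-j}·)` equals `1` on the `j`-th bump and the other dilates vanish there. The symbol
therefore multiplies the `j`-th term by `2^{jd} e^{-i 2^{j+1} θ·x}`, which cancels the coefficient
and turns the frequency `2^j θ` into `-2^j θ`. The cut-offs by `ψ` are removed by dominated
convergence (`isLimit_chingSymbol`). -/

section

variable {n : ℕ}

/-! ### Exponentials -/

@[simp] theorem norm_expi (ξ x : Rn n) : ‖expi ξ x‖ = 1 := by
  rw [expi, mul_comm, Complex.norm_exp_ofReal_mul_I]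

theorem expi_add (ξ η x : Rn n) : expi (ξ + η) x = expi ξ x * expi η x := by
  simp only [expi, ← Complex.exp_add, inner_add_right]
  push_cast
  ring_nf

theorem expi_comm (ξ x : Rn n) : expi ξ x = expi x ξ := by
  simp only [expi, real_inner_comm]

theorem expi_neg_left (ξ x : Rn n) : expi (-ξ) x = expi ξ (-x) := by
  simp only [expi, inner_neg_left, inner_neg_right]

/-! ### The Fourier transformation -/

/-- Multiplication of a Schwartz function by `e^{i x·ξ}`. -/
noncomputable def modulate (ξ : Rn n) : 𝓢(Rn n, ℂ) →L[ℂ] 𝓢(Rn n, ℂ) :=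
  SchwartzMap.smulLeftCLM ℂ (expi ξ)

@[simp] theorem modulate_apply (ξ : Rn n) (f : 𝓢(Rn n, ℂ)) (x : Rn n) :
    modulate ξ f x = expi ξ x * f x := by
  simp [modulate, SchwartzMap.smulLeftCLM_apply_apply (hasTemperateGrowth_expi _)]

/-- The product of two Schwartz functions. -/
noncomputable def mulS (v : 𝓢(Rn n, ℂ)) : 𝓢(Rn n, ℂ) →L[ℂ] 𝓢(Rn n, ℂ) :=
  SchwartzMap.smulLeftCLM ℂ v

@[simp] theorem mulS_apply (v f : 𝓢(Rn n, ℂ)) (x : Rn n) : mulS v f x = v x * f x := by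
  simp [mulS, SchwartzMap.smulLeftCLM_apply_apply v.hasTemperateGrowth]

theorem fourierS_eq_fourier (f : 𝓢(Rn n, ℂ)) (ξ : Rn n) :
    fourierS f ξ = (FourierTransform.fourier f : 𝓢(Rn n, ℂ)) ((2 * Real.pi)⁻¹ • ξ) := rfl

theorem fourier_eq_fourierS (f : 𝓢(Rn n, ℂ)) (ξ : Rn n) :
    (FourierTransform.fourier f : 𝓢(Rn n, ℂ)) ξ = fourierS f ((2 * Real.pi) • ξ) := by
  rw [fourierS_eq_fourier, smul_smul, inv_mul_cancel₀ (by positivity), one_smul]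

theorem fourierS_modulate (a : Rn n) (f : 𝓢(Rn n, ℂ)) (ξ : Rn n) :
    fourierS (modulate a f) ξ = fourierS f (ξ - a) := by
  rw [fourierS_apply, fourierS_apply]
  refine integral_congr_ae (.of_forall fun x => ?_)
  simp only [modulate_apply]
  rw [sub_eq_add_neg, expi_add, expi_neg_left a, neg_neg]
  ring

theorem integral_fourierS_mul (f g : 𝓢(Rn n, ℂ)) :
    ∫ ξ, fourierS f ξ * g ξ = ∫ x, f x * fourierS g x := by
  -- Scaling the pairing by `(2π)⁻¹` turns the kernel `e^{-2πi⟨x,ξ⟩}` into `e^{-i⟨x,ξ⟩}`.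
  have h := VectorFourier.integral_bilin_fourierIntegral_eq_flip
    (μ := (volume : Measure (Rn n))) (ν := (volume : Measure (Rn n)))
    (e := Real.fourierChar) (L := (2 * Real.pi)⁻¹ • (innerₗ (Rn n)))
    (f := f) (g := g) (ContinuousLinearMap.mul ℂ ℂ) Real.continuous_fourierChar
    (by simp only [LinearMap.smul_apply, innerₗ_apply_apply]; fun_prop) f.integrable g.integrable
  have e1 : ∀ (h : 𝓢(Rn n, ℂ)) ξ, VectorFourier.fourierIntegral Real.fourierChar volume
      ((2 * Real.pi)⁻¹ • (innerₗ (Rn n))) h ξ = fourierS h ξ := by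
    intro h ξ
    rw [fourierS_apply, VectorFourier.fourierIntegral]
    refine integral_congr_ae (.of_forall fun x => ?_)
    simp only [LinearMap.smul_apply, innerₗ_apply_apply, Circle.smul_def, Real.fourierChar_apply,
      smul_eq_mul, expi]
    congr 2
    rw [inner_neg_left]
    push_cast
    have : (Real.pi : ℂ) ≠ 0 := by exact_mod_cast Real.pi_ne_zero
    field_simp
  have e2 : ((2 * Real.pi)⁻¹ • (innerₗ (Rn n)) : Rn n →ₗ[ℝ] Rn n →ₗ[ℝ] ℝ).flip =
      (2 * Real.pi)⁻¹ • (innerₗ (Rn n)) := by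
    ext x y
    simp [real_inner_comm]
  simpa only [e1, e2, ContinuousLinearMap.mul_apply'] using h

theorem fourierS_fourierS (f : 𝓢(Rn n, ℂ)) (x : Rn n) :
    fourierS (fourierS f) x = ((2 * Real.pi : ℝ) : ℂ) ^ n * f (-x) := by
  have hinv : f (-x) = (FourierTransformInv.fourierInv
      (FourierTransform.fourier f : 𝓢(Rn n, ℂ)) : 𝓢(Rn n, ℂ)) (-x) := by
    rw [FourierTransform.fourierInv_fourier_eq]
  rw [hinv, SchwartzMap.fourierInv_coe, Real.fourierInv_eq', fourierS_apply]
  have h := Measure.integral_comp_smul (volume : Measure (Rn n))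
    (fun y => expi x (-((2 * Real.pi) • y)) * (FourierTransform.fourier f : 𝓢(Rn n, ℂ)) y)
    ((2 * Real.pi)⁻¹)
  have h1 : ∀ y, expi x (-((2 * Real.pi) • (2 * Real.pi)⁻¹ • y)) = expi x (-y) := by
    intro y
    rw [smul_smul, mul_inv_cancel₀ (by positivity), one_smul]
  simp only [h1] at h
  simp only [fourierS_eq_fourier]
  rw [h]
  have h2 : |(((2 * Real.pi)⁻¹ : ℝ) ^ Module.finrank ℝ (Rn n))⁻¹| = (2 * Real.pi) ^ n := by
    rw [finrank_euclideanSpace_fin, inv_pow, inv_inv, abs_of_nonneg (by positivity)]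
  rw [h2, Complex.real_smul, Complex.ofReal_pow]
  congr 1
  refine integral_congr_ae (.of_forall fun y => ?_)
  simp only [expi, smul_eq_mul]
  congr 2
  simp only [inner_neg_right, inner_neg_left, real_inner_smul_left]
  push_cast
  ring

theorem fourierS_injective : Function.Injective (fourierS (n := n)) := by
  intro f g h
  ext x
  have h1 := fourierS_fourierS f (-x)
  rw [h, fourierS_fourierS, neg_neg] at h1
  have h2 : ((2 * Real.pi : ℝ) : ℂ) ^ n ≠ 0 := by
    have := Real.pi_pos
    exact pow_ne_zero _ (by exact_mod_cast (by positivity : (2 * Real.pi : ℝ) ≠ 0))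
  exact (mul_left_cancel₀ h2 h1).symm

/-! ### Lacunary sums -/

/-- Spending `M ≥ 1 - d` powers of `2^j` absorbs the coefficient and leaves a geometric factor.
Hence any sequence decaying to order `M` is summable against `2^{-jd}`, whatever the sign of `d`. -/
theorem two_rpow_neg_mul_le {d : ℝ} {M : ℕ} (hM : 1 ≤ d + M) (j : ℕ) :
    (2 : ℝ) ^ (-((j : ℝ) * d)) ≤ (1 / 2) ^ j * ((2 : ℝ) ^ j) ^ M := by
  have h : ((1 / 2 : ℝ) ^ j * ((2 : ℝ) ^ j) ^ M) = (2 : ℝ) ^ (-(j : ℝ) + j * M) := by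
    rw [Real.rpow_add two_pos, Real.rpow_neg two_pos.le, Real.rpow_natCast,
      Real.rpow_mul two_pos.le,
      Real.rpow_natCast, Real.rpow_natCast, one_div, inv_pow]
  rw [h]
  refine Real.rpow_le_rpow_of_exponent_le one_le_two ?_
  have hj : (0 : ℝ) ≤ j := j.cast_nonneg
  nlinarith

theorem exists_nat_one_le_add (d : ℝ) : ∃ M : ℕ, 1 ≤ d + M := by
  obtain ⟨M, hM⟩ := exists_nat_ge (1 - d)
  exact ⟨M, by linarith⟩

/-- The coefficient `2^{-jd}`. -/
noncomputable def dyadicCoeff (d : ℝ) (j : ℕ) : ℂ := (((2 : ℝ) ^ (-((j : ℝ) * d)) : ℝ) : ℂ)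

theorem norm_dyadicCoeff (d : ℝ) (j : ℕ) : ‖dyadicCoeff d j‖ = (2 : ℝ) ^ (-((j : ℝ) * d)) := by
  rw [dyadicCoeff, Complex.norm_real, Real.norm_of_nonneg (by positivity)]

/-- The majorant is normalized to sum to exactly `C`, so the bound on the terms passes unchanged to
the sum. -/
theorem norm_dyadicCoeff_mul_le {d : ℝ} {M : ℕ} (hM : 1 ≤ d + M) {a : ℕ → ℂ} {C : ℝ}
    (ha : ∀ j, ((2 : ℝ) ^ (j + 1)) ^ M * ‖a j‖ ≤ C) (j : ℕ) :
    ‖dyadicCoeff d (j + 1) * a j‖ ≤ C * ((1 / 2) * (1 / 2) ^ j) := by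
  rw [norm_mul, norm_dyadicCoeff]
  calc (2 : ℝ) ^ (-(((j + 1 : ℕ) : ℝ) * d)) * ‖a j‖
      ≤ ((1 / 2) ^ (j + 1) * ((2 : ℝ) ^ (j + 1)) ^ M) * ‖a j‖ := by
        gcongr
        exact two_rpow_neg_mul_le hM (j + 1)
    _ = (((2 : ℝ) ^ (j + 1)) ^ M * ‖a j‖) * ((1 / 2) * (1 / 2) ^ j) := by ring
    _ ≤ _ := by
        gcongr
        exact ha j

theorem hasSum_half_mul (C : ℝ) : HasSum (fun j : ℕ => C * ((1 / 2) * (1 / 2 : ℝ) ^ j)) C := by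
  have h := (hasSum_geometric_two.mul_left (1 / 2 : ℝ)).mul_left C
  rwa [show C * (1 / 2 * 2) = C by ring] at h

theorem summable_dyadicCoeff_mul {d : ℝ} {M : ℕ} (hM : 1 ≤ d + M) {a : ℕ → ℂ} {C : ℝ}
    (ha : ∀ j, ((2 : ℝ) ^ (j + 1)) ^ M * ‖a j‖ ≤ C) :
    Summable fun j => dyadicCoeff d (j + 1) * a j :=
  .of_norm_bounded (hasSum_half_mul C).summable (norm_dyadicCoeff_mul_le hM ha)

theorem norm_tsum_dyadicCoeff_mul_le {d : ℝ} {M : ℕ} (hM : 1 ≤ d + M) {a : ℕ → ℂ} {C : ℝ}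
    (ha : ∀ j, ((2 : ℝ) ^ (j + 1)) ^ M * ‖a j‖ ≤ C) :
    ‖∑' j, dyadicCoeff d (j + 1) * a j‖ ≤ C :=
  tsum_of_norm_bounded (hasSum_half_mul C) (norm_dyadicCoeff_mul_le hM ha)

theorem norm_two_pow_smul {θ : Rn n} (hθ : ‖θ‖ = 1) (j : ℕ) : ‖(2 : ℝ) ^ j • θ‖ = 2 ^ j := by
  rw [norm_smul, hθ, mul_one, Real.norm_of_nonneg (by positivity)]

theorem two_pow_mul_norm_apply_le {θ : Rn n} (hθ : ‖θ‖ = 1) (M : ℕ) (f : 𝓢(Rn n, ℂ)) (j : ℕ) :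
    ((2 : ℝ) ^ (j + 1)) ^ M * ‖f (-((2 : ℝ) ^ (j + 1) • θ))‖ ≤ SchwartzMap.seminorm ℂ M 0 f := by
  have h := SchwartzMap.norm_pow_mul_le_seminorm ℂ f M (-((2 : ℝ) ^ (j + 1) • θ))
  rwa [norm_neg, norm_two_pow_smul hθ] at h

/-- The functional `f ↦ ∑_{j ≥ 1} 2^{-jd} f(-2^j θ)` on Schwartz functions. -/
noncomputable def lacunaryEval (d : ℝ) (θ : Rn n) (hθ : ‖θ‖ = 1) : 𝓢(Rn n, ℂ) →L[ℂ] ℂ :=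
  SchwartzMap.mkCLMtoNormedSpace
    (fun f => ∑' j : ℕ, dyadicCoeff d (j + 1) * f (-((2 : ℝ) ^ (j + 1) • θ)))
    (fun f g => by
      obtain ⟨M, hM⟩ := exists_nat_one_le_add d
      rw [← (summable_dyadicCoeff_mul hM (two_pow_mul_norm_apply_le hθ M f)).tsum_add
        (summable_dyadicCoeff_mul hM (two_pow_mul_norm_apply_le hθ M g))]
      simp [mul_add])
    (fun a f => by
      simp only [smul_apply, smul_eq_mul, RingHom.id_apply, ← tsum_mul_left]
      exact tsum_congr fun j => by ring)
    (by
      obtain ⟨M, hM⟩ := exists_nat_one_le_add d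
      refine ⟨{(M, 0)}, 1, zero_le_one, fun f => ?_⟩
      simpa using norm_tsum_dyadicCoeff_mul_le hM (two_pow_mul_norm_apply_le hθ M f))

/-! ### The distributions `w(θ, d)` -/

theorem wTerm_eq (d : ℝ) (θ : Rn n) (v : 𝓢(Rn n, ℂ)) (j : ℕ) :
    wTerm d θ v j = dyadicCoeff d j • modulate ((2 : ℝ) ^ j • θ) v := rfl

/-- Integration against an exponential samples a Fourier transform, so `w(θ,d)` only sees the values
of `(vφ)^` at the lacunary points `-2^j θ`, `j ≥ 1`. -/
theorem wTermDist_apply (d : ℝ) (θ : Rn n) (v φ : 𝓢(Rn n, ℂ)) (j : ℕ) :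
    wTermDist d θ v j φ =
      dyadicCoeff d (j + 1) * fourierS (mulS v φ) (-((2 : ℝ) ^ (j + 1) • θ)) := by
  refine (SchwartzMap.toTemperedDistributionCLM_apply_apply volume _ φ).trans ?_
  rw [fourierS_apply, ← integral_const_mul]
  refine integral_congr_ae (.of_forall fun x => ?_)
  simp only [wTerm_eq, smul_apply, modulate_apply, mulS_apply, smul_eq_mul,
    expi_neg_left, neg_neg]
  ring

theorem hasSum_wTermDist (d : ℝ) {θ : Rn n} (hθ : ‖θ‖ = 1) (v : 𝓢(Rn n, ℂ)) :
    HasSum (wTermDist d θ v) (ContinuousLinearMap.toPointwiseConvergenceCLM _ _ _ _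
      ((lacunaryEval d θ hθ).comp (fourierS.comp (mulS v)))) := by
  rw [HasSum, PointwiseConvergenceCLM.tendsto_iff_forall_tendsto]
  intro φ
  obtain ⟨M, hM⟩ := exists_nat_one_le_add d
  have h := (summable_dyadicCoeff_mul hM
    (two_pow_mul_norm_apply_le hθ M (fourierS (mulS v φ)))).hasSum
  rw [HasSum] at h
  convert h using 2 with s
  · rw [sum_apply]
    simp [wTermDist_apply]
  · rfl

theorem hasSum_wDist (d : ℝ) {θ : Rn n} (hθ : ‖θ‖ = 1) (v : 𝓢(Rn n, ℂ)) :
    HasSum (wTermDist d θ v) (wDist d θ v) :=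
  (hasSum_wTermDist d hθ v).summable.hasSum

theorem wDist_apply (d : ℝ) {θ : Rn n} (hθ : ‖θ‖ = 1) (v φ : 𝓢(Rn n, ℂ)) :
    wDist d θ v φ =
      ∑' j : ℕ, dyadicCoeff d (j + 1) * fourierS (mulS v φ) (-((2 : ℝ) ^ (j + 1) • θ)) := by
  rw [wDist, (hasSum_wTermDist d hθ v).tsum_eq]
  rfl

theorem fourierLoc_wDist (d : ℝ) {θ : Rn n} (hθ : ‖θ‖ = 1) (v : 𝓢(Rn n, ℂ)) (φ : TestFn n)
    (η : Rn n) :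
    fourierLoc (toDistr (wDist d θ v)) φ η = ∑' j : ℕ, dyadicCoeff d (j + 1) *
      fourierS (mulS v (TestFn.toSchwartz φ)) (η - (2 : ℝ) ^ (j + 1) • θ) := by
  rw [fourierLoc, toDistr_apply, wDist_apply d hθ]
  have h : mulS v (TestFn.toSchwartz (φ.mulSmooth (expi (-η)) (contDiff_expi _))) =
      modulate (-η) (mulS v (TestFn.toSchwartz φ)) := by
    ext x
    simp only [mulS_apply, TestFn.toSchwartz_apply, TestFn.mulSmooth_apply, modulate_apply]
    ring
  rw [h]
  simp only [fourierS_modulate]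
  refine tsum_congr fun j => ?_
  congr 2
  abel

/-! ### Unique continuation for band-limited functions -/

/-- Restricted to a line, the Fourier transform of a compactly supported function is entire. -/
theorem differentiable_integral_cexp {f : 𝓢(Rn n, ℂ)} {R : ℝ}
    (hf : tsupport f ⊆ Metric.closedBall 0 R) (x y : Rn n) :
    Differentiable ℂ fun z : ℂ => ∫ η,
      Complex.exp (-Complex.I * ((⟪x, η⟫ : ℝ) + z * (⟪y, η⟫ : ℝ))) * f η := by
  intro z₀
  have hcont : ∀ z : ℂ, Continuous fun η : Rn n =>
      Complex.exp (-Complex.I * ((⟪x, η⟫ : ℝ) + z * (⟪y, η⟫ : ℝ))) := by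
    intro z
    have h1 : Continuous fun η : Rn n => ((⟪x, η⟫ : ℝ) : ℂ) :=
      Complex.continuous_ofReal.comp (by fun_prop)
    have h2 : Continuous fun η : Rn n => ((⟪y, η⟫ : ℝ) : ℂ) :=
      Complex.continuous_ofReal.comp (by fun_prop)
    fun_prop
  have hcont' : Continuous fun η : Rn n => -Complex.I * ((⟪y, η⟫ : ℝ) : ℂ) :=
    continuous_const.mul (Complex.continuous_ofReal.comp (by fun_prop))
  have hcs : HasCompactSupport f :=
    HasCompactSupport.intro' (isCompact_closedBall 0 R) Metric.isClosed_closedBall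
      fun η hη => image_eq_zero_of_notMem_tsupport fun h => hη (hf h)
  have hnorm : ∀ (z : ℂ) (η : Rn n),
      ‖Complex.exp (-Complex.I * ((⟪x, η⟫ : ℝ) + z * (⟪y, η⟫ : ℝ)))‖ =
        Real.exp (z.im * ⟪y, η⟫) := by
    intro z η
    rw [Complex.norm_exp]
    simp
  -- On the unit disc around `z₀` one has `|Im z| ≤ ‖z₀‖ + 1`; the resulting exponential majorant is
  -- integrable because `f` has compact support.
  have key := hasDerivAt_integral_of_dominated_loc_of_deriv_le (μ := (volume : Measure (Rn n)))
    (F := fun (z : ℂ) η => Complex.exp (-Complex.I * ((⟪x, η⟫ : ℝ) + z * (⟪y, η⟫ : ℝ))) * f η)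
    (F' := fun (z : ℂ) η => Complex.exp (-Complex.I * ((⟪x, η⟫ : ℝ) + z * (⟪y, η⟫ : ℝ))) *
      (-Complex.I * (⟪y, η⟫ : ℝ)) * f η) (x₀ := z₀)
    (s := Metric.ball z₀ 1)
    (bound := fun η => Real.exp ((‖z₀‖ + 1) * |⟪y, η⟫|) * |⟪y, η⟫| * ‖f η‖)
    (Metric.ball_mem_nhds z₀ one_pos)
    (.of_forall fun z => ((hcont z).mul f.continuous).aestronglyMeasurable)
    (((hcont z₀).mul f.continuous).integrable_of_hasCompactSupport hcs.mul_left)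
    (((hcont z₀).mul hcont').mul f.continuous).aestronglyMeasurable
    (.of_forall fun η z hz => ?_)
    (Continuous.integrable_of_hasCompactSupport
      (by have := f.continuous; fun_prop) hcs.norm.mul_left)
    (.of_forall fun η z hz => ?_)
  · exact key.2.differentiableAt
  · rw [norm_mul, norm_mul, hnorm, norm_mul, norm_neg, Complex.norm_I, one_mul, Complex.norm_real,
      Real.norm_eq_abs]
    gcongr ?_ * _ * _
    refine Real.exp_le_exp.2 ((le_abs_self _).trans ?_)
    rw [abs_mul]
    gcongr
    refine (Complex.abs_im_le_norm z).trans ?_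
    have h1 : ‖z - z₀‖ < 1 := by simpa [dist_eq_norm] using hz
    calc ‖z‖ = ‖z₀ + (z - z₀)‖ := by congr 1; ring
      _ ≤ ‖z₀‖ + ‖z - z₀‖ := norm_add_le _ _
      _ ≤ _ := by linarith
  · have h1 : HasDerivAt (fun z : ℂ => -Complex.I * ((⟪x, η⟫ : ℝ) + z * (⟪y, η⟫ : ℝ)))
        (-Complex.I * (1 * (⟪y, η⟫ : ℝ))) z :=
      (((hasDerivAt_id z).mul_const _).const_add _).const_mul _
    simpa using (h1.cexp).mul_const (f η)

/-- A Schwartz function with compactly supported Fourier transform is determined by its germ at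
any point. -/
theorem eq_zero_of_eventually_eq_zero {v : 𝓢(Rn n, ℂ)} {R : ℝ}
    (hv : tsupport (fourierS v) ⊆ Metric.closedBall 0 R) {x : Rn n}
    (hx : ∀ᶠ y in 𝓝 x, v y = 0) : v = 0 := by
  ext y
  -- For real `t` this is `(2π)^n v` on the line that passes through `x` at `t = 0` and `y` at `t =
  -- 1`. The identity theorem carries the vanishing near `0` to `1`.
  set g : ℂ → ℂ := fun z => ∫ η, Complex.exp (-Complex.I * ((⟪-x, η⟫ : ℝ) +
    z * (⟪x - y, η⟫ : ℝ))) * fourierS v η with hg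
  have hd : Differentiable ℂ g := differentiable_integral_cexp hv (-x) (x - y)
  have hval : ∀ t : ℝ, g t = ((2 * Real.pi : ℝ) : ℂ) ^ n * v (x + t • (y - x)) := by
    intro t
    have h1 : x + t • (y - x) = -(-x + t • (x - y)) := by
      rw [neg_add, neg_neg, ← smul_neg, neg_sub]
    rw [h1, ← fourierS_fourierS, fourierS_apply]
    refine integral_congr_ae (.of_forall fun η => ?_)
    simp only [expi, inner_neg_left, inner_add_right, inner_smul_right, real_inner_comm η]
    congr 2
    push_cast
    ring
  have h2 : ((2 * Real.pi : ℝ) : ℂ) ^ n ≠ 0 := by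
    have := Real.pi_pos
    exact pow_ne_zero _ (by exact_mod_cast (by positivity : (2 * Real.pi : ℝ) ≠ 0))
  have hreal : ∀ᶠ t : ℝ in 𝓝 0, g t = 0 := by
    have hc : Tendsto (fun t : ℝ => x + t • (y - x)) (𝓝 0) (𝓝 x) := by
      have : Continuous fun t : ℝ => x + t • (y - x) := by fun_prop
      simpa using this.tendsto 0
    filter_upwards [hc.eventually hx] with t ht
    rw [hval, ht, mul_zero]
  have hfreq : ∃ᶠ z in 𝓝[≠] (0 : ℂ), g z = 0 := by
    have h3 : Tendsto (fun t : ℝ => (t : ℂ)) (𝓝[≠] 0) (𝓝[≠] 0) := by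
      refine tendsto_nhdsWithin_iff.2 ⟨?_, ?_⟩
      · simpa using (Complex.continuous_ofReal.tendsto 0).mono_left nhdsWithin_le_nhds
      · filter_upwards [self_mem_nhdsWithin] with t ht
        simpa using ht
    exact h3.frequently (hreal.filter_mono nhdsWithin_le_nhds).frequently
  have hzero : g = 0 := (Complex.analyticOnNhd_univ_iff_differentiable.2 hd).eq_of_frequently_eq
    (analyticOnNhd_const (v := (0 : ℂ))) (z₀ := 0) hfreq
  have h4 := hval 1
  rw [hzero] at h4
  simpa [Real.pi_ne_zero] using h4.symm

/-! ### Wavefront sets of lacunary sums -/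

/-- With `r = ‖η‖`, use `r² + t² - 2crt = (1-c)(r² + t²) + c(r-t)²` and `r² + t² ≥ (r+t)²/2`. -/
theorem norm_sub_smul_ge {θ η : Rn n} (hθ : ‖θ‖ = 1) {c t : ℝ} (hc0 : 0 ≤ c) (hc1 : c < 1)
    (ht : 0 ≤ t) (hη : ⟪η, θ⟫ ≤ c * ‖η‖) :
    √((1 - c) / 2) * (‖η‖ + t) ≤ ‖η - t • θ‖ := by
  refine le_of_sq_le_sq ?_ (norm_nonneg _)
  rw [mul_pow, Real.sq_sqrt (by linarith), norm_sub_sq_real, inner_smul_right, norm_smul, hθ,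
    Real.norm_of_nonneg ht]
  have h1 : t * ⟪η, θ⟫ ≤ t * (c * ‖η‖) := by gcongr
  nlinarith [sq_nonneg (‖η‖ - t), mul_nonneg ht (norm_nonneg η)]

/-- In a cone avoiding `θ`, decay of `F` of order `N + M` splits through `‖η - 2^j θ‖ ≥ κ(‖η‖ +
2^j)` into `(1 + ‖η‖)^{-N}`, which is the claim, and `2^{-jM}`, which makes the series converge. -/
theorem isMicroRegular_wDist (d : ℝ) {θ : Rn n} (hθ : ‖θ‖ = 1) (v : 𝓢(Rn n, ℂ)) (x : Rn n)
    {ξ : Rn n} (hξ0 : ξ ≠ 0) (hξ : ξ ∉ openRay θ) :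
    IsMicroRegular (toDistr (wDist d θ v)) x ξ := by
  let b : ContDiffBump x := ⟨1, 2, one_pos, one_lt_two⟩
  let φ : TestFn n := ⟨fun y => ((b y : ℝ) : ℂ), Complex.ofRealCLM.contDiff.comp b.contDiff,
    b.hasCompactSupport.comp_left Complex.ofReal_zero, fun _ _ => trivial⟩
  have hφ : φ x ≠ 0 := by
    change ((b x : ℝ) : ℂ) ≠ 0
    rw [b.one_of_mem_closedBall (by simp [b])]
    simp
  -- Equality in Cauchy–Schwarz would put `ξ` on the ray.
  have hlt : ⟪ξ, θ⟫ < ‖ξ‖ := by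
    have h1 := real_inner_le_norm ξ θ
    rw [hθ, mul_one] at h1
    refine lt_of_le_of_ne h1 fun h => hξ ?_
    have h2 := (inner_eq_norm_mul_iff_real (x := ξ) (y := θ)).1 (by rw [h, hθ, mul_one])
    rw [hθ, one_smul] at h2
    exact ⟨‖ξ‖, norm_pos_iff.2 hξ0, h2⟩
  have hξp : 0 < ‖ξ‖ := norm_pos_iff.2 hξ0
  obtain ⟨c, hc0, hc1, hc⟩ : ∃ c : ℝ, 0 ≤ c ∧ c < 1 ∧ ⟪ξ, θ⟫ < c * ‖ξ‖ := by
    obtain ⟨c, h1, h2⟩ := exists_between (max_lt ((div_lt_one hξp).2 hlt) zero_lt_one)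
    exact ⟨c, (le_max_right _ _).trans h1.le, h2,
      (div_lt_iff₀ hξp).1 ((le_max_left _ _).trans_lt h1)⟩
  refine ⟨φ, hφ, {η | ⟪η, θ⟫ < c * ‖η‖}, isOpen_lt (by fun_prop) (by fun_prop), hc, ?_, fun N => ?_⟩
  · intro t ht η hη
    simp only [Set.mem_ofPred_eq, real_inner_smul_left, norm_smul, Real.norm_of_nonneg ht.le]
      at hη ⊢
    nlinarith
  obtain ⟨M, hM⟩ := exists_nat_one_le_add d
  set F := fourierS (mulS v (TestFn.toSchwartz φ)) with hF
  set κ := √((1 - c) / 2) with hκ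
  have hκp : 0 < κ := Real.sqrt_pos.2 (by linarith)
  refine ⟨SchwartzMap.seminorm ℂ (N + M) 0 F / κ ^ (N + M), fun η hη => ?_⟩
  rw [fourierLoc_wDist d hθ]
  have h1 : ∀ j : ℕ, ((2 : ℝ) ^ (j + 1)) ^ M *
      ‖((1 + ‖η‖ : ℝ) : ℂ) ^ N * F (η - (2 : ℝ) ^ (j + 1) • θ)‖ ≤
      SchwartzMap.seminorm ℂ (N + M) 0 F / κ ^ (N + M) := by
    intro j
    have h2 := SchwartzMap.norm_pow_mul_le_seminorm ℂ F (N + M) (η - (2 : ℝ) ^ (j + 1) • θ)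
    have h3 := norm_sub_smul_ge hθ hc0 hc1 (by positivity : (0 : ℝ) ≤ 2 ^ (j + 1)) (le_of_lt hη)
    have h4 : (1 : ℝ) ≤ 2 ^ (j + 1) := one_le_pow₀ one_le_two
    rw [le_div_iff₀ (by positivity), norm_mul, norm_pow, Complex.norm_real,
      Real.norm_of_nonneg (by positivity)]
    refine le_trans ?_ h2
    calc ((2 : ℝ) ^ (j + 1)) ^ M * ((1 + ‖η‖) ^ N * ‖F (η - (2 : ℝ) ^ (j + 1) • θ)‖) * κ ^ (N + M)
        = ((1 + ‖η‖) ^ N * ((2 : ℝ) ^ (j + 1)) ^ M) * κ ^ (N + M) *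
            ‖F (η - (2 : ℝ) ^ (j + 1) • θ)‖ := by ring
      _ ≤ ((‖η‖ + 2 ^ (j + 1)) ^ N * (‖η‖ + 2 ^ (j + 1)) ^ M) * κ ^ (N + M) *
            ‖F (η - (2 : ℝ) ^ (j + 1) • θ)‖ := by
          have := norm_nonneg η
          gcongr ?_ ^ N * ?_ ^ M * _ * _ <;> linarith
      _ = (κ * (‖η‖ + 2 ^ (j + 1))) ^ (N + M) * ‖F (η - (2 : ℝ) ^ (j + 1) • θ)‖ := by
          rw [mul_pow, pow_add (‖η‖ + _)]
          ring
      _ ≤ _ := by gcongr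
  have h5 := norm_tsum_dyadicCoeff_mul_le hM h1
  have h6 : ∀ j : ℕ, dyadicCoeff d (j + 1) *
      (((1 + ‖η‖ : ℝ) : ℂ) ^ N * F (η - (2 : ℝ) ^ (j + 1) • θ)) =
      ((1 + ‖η‖ : ℝ) : ℂ) ^ N * (dyadicCoeff d (j + 1) * F (η - (2 : ℝ) ^ (j + 1) • θ)) :=
    fun j => by ring
  simp only [h6] at h5
  rwa [tsum_mul_left, norm_mul, norm_pow, Complex.norm_real,
    Real.norm_of_nonneg (by positivity)] at h5

/-- The distance of two different frequencies `2^j θ` and `2^k θ`. -/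
theorem norm_add_two_pow_smul_sub_ge {θ ζ : Rn n} (hθ : ‖θ‖ = 1) {j k : ℕ} (hjk : j ≠ k)
    (hk : 4 * ‖ζ‖ ≤ 2 ^ k) :
    (2 : ℝ) ^ j ≤ 4 * ‖ζ + (2 : ℝ) ^ k • θ - (2 : ℝ) ^ j • θ‖ ∧
      (2 : ℝ) ^ k ≤ 4 * ‖ζ + (2 : ℝ) ^ k • θ - (2 : ℝ) ^ j • θ‖ := by
  -- Distinct powers of two differ by at least half the larger one, and `ζ` removes at most a
  -- quarter of `2^k`; hence the factor `4`.
  have h1 : |(2 : ℝ) ^ k - 2 ^ j| ≤ ‖ζ + (2 : ℝ) ^ k • θ - (2 : ℝ) ^ j • θ‖ + ‖ζ‖ := by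
    have h2 : ‖((2 : ℝ) ^ k - 2 ^ j) • θ‖ = |(2 : ℝ) ^ k - 2 ^ j| := by
      rw [norm_smul, hθ, mul_one, Real.norm_eq_abs]
    rw [← h2]
    have h3 : ((2 : ℝ) ^ k - 2 ^ j) • θ = (ζ + (2 : ℝ) ^ k • θ - (2 : ℝ) ^ j • θ) - ζ := by
      rw [sub_smul]
      abel
    rw [h3]
    exact norm_sub_le _ _
  have hj0 : (0 : ℝ) < 2 ^ j := by positivity
  have hk0 : (0 : ℝ) < 2 ^ k := by positivity
  rcases lt_or_gt_of_ne hjk with h | h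
  · have h4 : (2 : ℝ) * 2 ^ j ≤ 2 ^ k := by
      rw [← pow_succ']
      exact pow_le_pow_right₀ one_le_two h
    rw [abs_of_nonneg (by linarith)] at h1
    constructor <;> linarith
  · have h4 : (2 : ℝ) * 2 ^ k ≤ 2 ^ j := by
      rw [← pow_succ']
      exact pow_le_pow_right₀ one_le_two h
    rw [abs_of_nonpos (by linarith)] at h1
    constructor <;> linarith

/-- If `∑_{j ≥ 1} 2^{-jd} F(· - 2^j θ)` decays rapidly in a cone around `θ`, then `F = 0`. -/
theorem eq_zero_of_lacunary_decay (d : ℝ) {θ : Rn n} (hθ : ‖θ‖ = 1) (F : 𝓢(Rn n, ℂ))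
    {Γ : Set (Rn n)} (hΓo : IsOpen Γ) (hθΓ : θ ∈ Γ)
    (hΓ : ∀ t : ℝ, 0 < t → ∀ η ∈ Γ, t • η ∈ Γ)
    (hdec : ∀ N : ℕ, ∃ C : ℝ, ∀ η ∈ Γ, (1 + ‖η‖) ^ N *
      ‖∑' j : ℕ, dyadicCoeff d (j + 1) * F (η - (2 : ℝ) ^ (j + 1) • θ)‖ ≤ C) : F = 0 := by
  ext ζ
  rw [zero_apply]
  obtain ⟨M, hM⟩ := exists_nat_one_le_add d
  -- Decay of order `N ≥ 1 + d` pays for dividing by the coefficient `2^{-kd}` at the end and still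
  -- leaves a factor `2^{-k}`.
  obtain ⟨N, hN⟩ := exists_nat_one_le_add (-d)
  obtain ⟨C, hC⟩ := hdec N
  set S := SchwartzMap.seminorm ℂ (M + N) 0 F with hS
  have hS0 : 0 ≤ S := apply_nonneg _ _
  have hpow : Tendsto (fun k : ℕ => (2 : ℝ) ^ (k + 1)) atTop atTop :=
    (tendsto_pow_atTop_atTop_of_one_lt one_lt_two).comp (tendsto_add_atTop_nat 1)
  -- By homogeneity of the cone it is enough that `θ + 2^{-(k+1)} ζ` lies in `Γ`, and this tends to
  -- `θ`.
  have hmem : ∀ᶠ k : ℕ in atTop, ζ + (2 : ℝ) ^ (k + 1) • θ ∈ Γ := by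
    have h1 : Tendsto (fun k : ℕ => θ + ((2 : ℝ) ^ (k + 1))⁻¹ • ζ) atTop (𝓝 θ) := by
      have := (tendsto_inv_atTop_zero.comp hpow).smul_const ζ
      simpa using this.const_add θ
    filter_upwards [h1.eventually (hΓo.mem_nhds hθΓ)] with k hk
    have h2 := hΓ ((2 : ℝ) ^ (k + 1)) (by positivity) _ hk
    rwa [smul_add, smul_smul, mul_inv_cancel₀ (by positivity), one_smul, add_comm] at h2
  have hbound : ∀ᶠ k : ℕ in atTop, ‖F ζ‖ ≤ (2 ^ N * C + 4 ^ (M + N) * S) * (1 / 2) ^ (k + 1) := by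
    filter_upwards [hmem, hpow.eventually_ge_atTop (4 * ‖ζ‖)] with k hk hkζ
    set η := ζ + (2 : ℝ) ^ (k + 1) • θ with hη
    -- This crude bound, whose constant depends on `η`, only serves summability, so that the `k`-th
    -- term can be split off.
    have hsum : ∀ j, ((2 : ℝ) ^ (j + 1)) ^ M *
        ‖F (η - (2 : ℝ) ^ (j + 1) • θ)‖ ≤ SchwartzMap.seminorm ℂ M 0 F * 2 ^ M +
          SchwartzMap.seminorm ℂ 0 0 F * (2 * ‖η‖) ^ M := by
      intro j
      have e1 := SchwartzMap.norm_pow_mul_le_seminorm ℂ F M (η - (2 : ℝ) ^ (j + 1) • θ)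
      have e2 := SchwartzMap.norm_le_seminorm ℂ F (η - (2 : ℝ) ^ (j + 1) • θ)
      have e3 : (2 : ℝ) ^ (j + 1) ≤ ‖η - (2 : ℝ) ^ (j + 1) • θ‖ + ‖η‖ := by
        have := norm_sub_norm_le ((2 : ℝ) ^ (j + 1) • θ) η
        rw [norm_sub_rev, norm_two_pow_smul hθ (j + 1)] at this
        linarith
      have p1 : 0 ≤ SchwartzMap.seminorm ℂ M 0 F := apply_nonneg _ _
      have p2 : 0 ≤ SchwartzMap.seminorm ℂ 0 0 F := apply_nonneg _ _
      rcases le_total ‖η‖ ‖η - (2 : ℝ) ^ (j + 1) • θ‖ with h | h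
      · calc _ ≤ (2 * ‖η - (2 : ℝ) ^ (j + 1) • θ‖) ^ M * ‖F (η - (2 : ℝ) ^ (j + 1) • θ)‖ := by
              gcongr; linarith
          _ = (‖η - (2 : ℝ) ^ (j + 1) • θ‖ ^ M * ‖F (η - (2 : ℝ) ^ (j + 1) • θ)‖) * 2 ^ M := by ring
          _ ≤ SchwartzMap.seminorm ℂ M 0 F * 2 ^ M := by gcongr
          _ ≤ _ := le_add_of_nonneg_right (by positivity)
      · calc _ ≤ (2 * ‖η‖) ^ M * SchwartzMap.seminorm ℂ 0 0 F := by gcongr; linarith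
          _ ≤ _ := by rw [mul_comm]; exact le_add_of_nonneg_left (by positivity)
    have hsm := summable_dyadicCoeff_mul hM hsum
    -- For `j ≠ k` the point `η - 2^{j+1} θ` has norm at least a quarter of both `2^{j+1}` and
    -- `2^{k+1}`: `M` orders of decay sum over `j`, and `N` orders give smallness in `k`.
    have hrest : ∀ j, ((2 : ℝ) ^ (j + 1)) ^ M *
        ‖(if j = k then 0 else F (η - (2 : ℝ) ^ (j + 1) • θ))‖ ≤
        4 ^ (M + N) * S / ((2 : ℝ) ^ (k + 1)) ^ N := by
      intro j
      split_ifs with hjk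
      · simp only [norm_zero, mul_zero]
        positivity
      · obtain ⟨g1, g2⟩ := norm_add_two_pow_smul_sub_ge hθ
          (fun h => hjk (by omega) : j + 1 ≠ k + 1) hkζ
        have e1 := SchwartzMap.norm_pow_mul_le_seminorm ℂ F (M + N) (η - (2 : ℝ) ^ (j + 1) • θ)
        rw [le_div_iff₀ (by positivity)]
        calc _ = (((2 : ℝ) ^ (j + 1)) ^ M * ((2 : ℝ) ^ (k + 1)) ^ N) *
              ‖F (η - (2 : ℝ) ^ (j + 1) • θ)‖ := by ring
          _ ≤ ((4 * ‖η - (2 : ℝ) ^ (j + 1) • θ‖) ^ M * (4 * ‖η - (2 : ℝ) ^ (j + 1) • θ‖) ^ N) *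
              ‖F (η - (2 : ℝ) ^ (j + 1) • θ)‖ := by gcongr
          _ = 4 ^ (M + N) * (‖η - (2 : ℝ) ^ (j + 1) • θ‖ ^ (M + N) *
              ‖F (η - (2 : ℝ) ^ (j + 1) • θ)‖) := by rw [pow_add, pow_add]; ring
          _ ≤ _ := by gcongr
    have hr := norm_tsum_dyadicCoeff_mul_le hM hrest
    have hsplit := hsm.tsum_eq_add_tsum_ite k
    have heq : ∀ j, (if j = k then 0 else dyadicCoeff d (j + 1) * F (η - (2 : ℝ) ^ (j + 1) • θ)) =
        dyadicCoeff d (j + 1) * (if j = k then 0 else F (η - (2 : ℝ) ^ (j + 1) • θ)) := by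
      intro j
      split_ifs <;> simp
    simp only [heq] at hsplit
    have hk' : η - (2 : ℝ) ^ (k + 1) • θ = ζ := by rw [hη, add_sub_cancel_right]
    rw [hk'] at hsplit
    have hG : ‖∑' j : ℕ, dyadicCoeff d (j + 1) * F (η - (2 : ℝ) ^ (j + 1) • θ)‖ ≤
        2 ^ N * C / ((2 : ℝ) ^ (k + 1)) ^ N := by
      have e1 := hC η hk
      have e2 : (2 : ℝ) ^ (k + 1) ≤ 2 * (1 + ‖η‖) := by
        have := norm_sub_le η ζ
        rw [hη, add_sub_cancel_left, norm_two_pow_smul hθ, ← hη] at this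
        have := norm_nonneg η
        linarith
      rw [le_div_iff₀ (by positivity), mul_comm]
      calc _ ≤ (2 * (1 + ‖η‖)) ^ N *
            ‖∑' j : ℕ, dyadicCoeff d (j + 1) * F (η - (2 : ℝ) ^ (j + 1) • θ)‖ := by gcongr
        _ = 2 ^ N * ((1 + ‖η‖) ^ N *
            ‖∑' j : ℕ, dyadicCoeff d (j + 1) * F (η - (2 : ℝ) ^ (j + 1) • θ)‖) := by
              rw [mul_pow]; ring
        _ ≤ _ := by gcongr
    have hF : ‖dyadicCoeff d (k + 1) * F ζ‖ ≤
        (2 ^ N * C + 4 ^ (M + N) * S) / ((2 : ℝ) ^ (k + 1)) ^ N := by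
      rw [eq_sub_of_add_eq hsplit.symm, add_div]
      exact (norm_sub_le _ _).trans (add_le_add hG hr)
    have hinv : dyadicCoeff (-d) (k + 1) * dyadicCoeff d (k + 1) = 1 := by
      rw [dyadicCoeff, dyadicCoeff, ← Complex.ofReal_mul, ← Real.rpow_add two_pos]
      simp
    have hFe : F ζ = dyadicCoeff (-d) (k + 1) * (dyadicCoeff d (k + 1) * F ζ) := by
      rw [← mul_assoc, hinv, one_mul]
    have hK : 0 ≤ (2 ^ N * C + 4 ^ (M + N) * S) / ((2 : ℝ) ^ (k + 1)) ^ N :=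
      (norm_nonneg _).trans hF
    rw [hFe, norm_mul, norm_dyadicCoeff]
    calc _ ≤ ((1 / 2) ^ (k + 1) * ((2 : ℝ) ^ (k + 1)) ^ N) *
          ((2 ^ N * C + 4 ^ (M + N) * S) / ((2 : ℝ) ^ (k + 1)) ^ N) := by
          gcongr
          exact two_rpow_neg_mul_le hN (k + 1)
      _ = _ := by field_simp
  have hlim : Tendsto (fun k : ℕ => (2 ^ N * C + 4 ^ (M + N) * S) * (1 / 2 : ℝ) ^ (k + 1)) atTop
      (𝓝 0) := by
    have := ((tendsto_pow_atTop_nhds_zero_of_lt_one (by norm_num : (0 : ℝ) ≤ 1 / 2)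
      (by norm_num)).comp (tendsto_add_atTop_nat 1)).const_mul (2 ^ N * C + 4 ^ (M + N) * S)
    simpa using this
  exact norm_le_zero_iff.1 (ge_of_tendsto hlim hbound)

/-- Any cone of decay meeting the ray contains `θ`, so decay gives `(vφ)^ = 0`, hence `vφ = 0`. Then
`v` vanishes near `x`, where `φ ≠ 0`, contradicting unique continuation. -/
theorem WF_wDist (d : ℝ) {θ : Rn n} (hθ : ‖θ‖ = 1) {v : 𝓢(Rn n, ℂ)} (hv0 : v ≠ 0) {R : ℝ}
    (hv : tsupport (fourierS v) ⊆ Metric.closedBall (0 : Rn n) R) :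
    WF (toDistr (wDist d θ v)) = Set.univ ×ˢ openRay θ := by
  ext ⟨x, ξ⟩
  simp only [WF, Set.mem_ofPred_eq, Set.mem_prod, Set.mem_univ, true_and]
  constructor
  · rintro ⟨h0, h⟩
    by_contra hξ
    exact h (isMicroRegular_wDist d hθ v x h0 hξ)
  · rintro ⟨t, ht, rfl⟩
    refine ⟨smul_ne_zero ht.ne' (norm_ne_zero_iff.1 (by rw [hθ]; exact one_ne_zero)), ?_⟩
    rintro ⟨φ, hφ, Γ, hΓo, hmem, hΓ, hdec⟩
    have hθΓ : θ ∈ Γ := by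
      have := hΓ t⁻¹ (inv_pos.2 ht) _ hmem
      rwa [smul_smul, inv_mul_cancel₀ ht.ne', one_smul] at this
    simp only [fourierLoc_wDist d hθ] at hdec
    have hF := eq_zero_of_lacunary_decay d hθ _ hΓo hθΓ hΓ hdec
    have hvφ : mulS v (TestFn.toSchwartz φ) = 0 := fourierS_injective (by rw [hF, map_zero])
    refine hv0 (eq_zero_of_eventually_eq_zero hv (x := x) ?_)
    filter_upwards [φ.contDiff.continuous.continuousAt.eventually_ne hφ] with y hy
    have h1 : mulS v (TestFn.toSchwartz φ) y = 0 := by rw [hvφ]; rfl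
    rw [mulS_apply, TestFn.toSchwartz_apply] at h1
    exact (mul_eq_zero.1 h1).resolve_right hy

/-! ### Ching's symbol -/

/-- The power is monotone or antitone according to the sign of `t`; adding both constants covers the
two cases. -/
theorem rpow_le_of_comparable {a b x y : ℝ} (ha : 0 < a) (hx : 0 < x) (h1 : a * x ≤ y)
    (h2 : y ≤ b * x) (t : ℝ) : y ^ t ≤ (a ^ t + b ^ t) * x ^ t := by
  have hy : 0 < y := (mul_pos ha hx).trans_le h1
  have hb : 0 < b := pos_of_mul_pos_left (hy.trans_le h2) hx.le
  rw [add_mul, ← Real.mul_rpow ha.le hx.le, ← Real.mul_rpow hb.le hx.le]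
  rcases le_total 0 t with ht | ht
  · exact (Real.rpow_le_rpow hy.le h2 ht).trans (le_add_of_nonneg_left (by positivity))
  · exact (Real.rpow_le_rpow_of_nonpos (mul_pos ha hx) h1 ht).trans
      (le_add_of_nonneg_right (by positivity))

theorem norm_iteratedFDeriv_expi_le (ξ x : Rn n) (l : ℕ) :
    ‖iteratedFDeriv ℝ l (expi ξ) x‖ ≤ ‖ξ‖ ^ l := by
  let g : ℝ → ℂ := fun t => Complex.exp (Complex.I * t)
  have hs : ContDiff ℝ ∞ g :=
    Complex.contDiff_exp.comp (contDiff_const.mul Complex.ofRealCLM.contDiff)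
  have hd : ∀ k : ℕ, iteratedDeriv k g =
    fun t : ℝ => Complex.I ^ k * Complex.exp (Complex.I * t) := by
    intro k
    induction k with
    | zero => simp [g]
    | succ k ih =>
      rw [iteratedDeriv_succ, ih]
      funext t
      have h1 : HasDerivAt (fun t : ℝ => Complex.I * (t : ℂ)) (Complex.I * 1) t :=
        (Complex.ofRealCLM.hasDerivAt).const_mul _
      rw [((h1.cexp).const_mul (Complex.I ^ k)).deriv]
      ring
  have hexpi : expi ξ = g ∘ (innerSL ℝ ξ) := by
    funext x
    simp [expi, g, real_inner_comm]
  rw [hexpi, (innerSL ℝ ξ).iteratedFDeriv_comp_right hs x (i := l) (by exact_mod_cast le_top)]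
  refine (ContinuousMultilinearMap.norm_compContinuousLinearMap_le _ _).trans ?_
  rw [norm_iteratedFDeriv_eq_norm_iteratedDeriv, hd]
  simp [mul_comm Complex.I, Complex.norm_exp_ofReal_mul_I]

theorem apply_inv_two_pow_smul_eq_zero {A : Rn n → ℂ}
    (hA : ∀ η, A η ≠ 0 → 3 / 4 ≤ ‖η‖ ∧ ‖η‖ ≤ 5 / 4) {η : Rn n} {k : ℕ}
    (h : ‖η‖ < 3 / 4 * 2 ^ k ∨ 5 / 4 * 2 ^ k < ‖η‖) : A (((2 : ℝ) ^ k)⁻¹ • η) = 0 := by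
  by_contra h0
  have h1 := hA _ h0
  rw [norm_smul, norm_inv, Real.norm_of_nonneg (by positivity), inv_mul_le_iff₀ (by positivity),
    le_inv_mul_iff₀ (by positivity)] at h1
  rcases h with h | h <;> linarith

/-- The annuli `3/4·2^k ≤ |η| ≤ 5/4·2^k` are separated by gaps since `5/4 < 3/2`. The value `7/5`
lies inside the gap, so comparing `‖η₀‖` with `7/5·2^j` selects the only possible index with strict,
hence stable, inequalities. -/
theorem exists_eventually_forall_ne_eq_zero {A : Rn n → ℂ}
    (hA : ∀ η, A η ≠ 0 → 3 / 4 ≤ ‖η‖ ∧ ‖η‖ ≤ 5 / 4) (η₀ : Rn n) :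
    ∃ j : ℕ, ∀ᶠ η in 𝓝 η₀, ∀ k, k ≠ j → A (((2 : ℝ) ^ k)⁻¹ • η) = 0 := by
  have hex : ∃ j : ℕ, ‖η₀‖ < 7 / 5 * 2 ^ j := by
    obtain ⟨j, hj⟩ := pow_unbounded_of_one_lt ‖η₀‖ one_lt_two
    exact ⟨j, hj.trans_le (by nlinarith [pow_pos (two_pos : (0 : ℝ) < 2) j])⟩
  classical
  refine ⟨Nat.find hex, ?_⟩
  have hlt : ∀ᶠ η in 𝓝 η₀, ‖η‖ < 7 / 5 * 2 ^ Nat.find hex :=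
    (continuous_norm.tendsto η₀).eventually_lt_const (Nat.find_spec hex)
  have hgt : ∀ᶠ η in 𝓝 η₀, ∀ k, k + 1 = Nat.find hex → 5 / 4 * 2 ^ k < ‖η‖ := by
    by_cases hm : ∃ m, m + 1 = Nat.find hex
    · obtain ⟨m, hm⟩ := hm
      have h1 := not_lt.1 (Nat.find_min hex (show m < Nat.find hex by omega))
      have h2 : 5 / 4 * (2 : ℝ) ^ m < ‖η₀‖ :=
        lt_of_lt_of_le (by nlinarith [pow_pos (two_pos : (0 : ℝ) < 2) m]) h1
      filter_upwards [(continuous_norm.tendsto η₀).eventually_const_lt h2] with η hη k hk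
      rwa [show k = m by omega]
    · exact .of_forall fun η k hk => (hm ⟨k, hk⟩).elim
  filter_upwards [hlt, hgt] with η h1 h2 k hk
  refine apply_inv_two_pow_smul_eq_zero hA ?_
  rcases lt_or_gt_of_ne hk with h | h
  · right
    obtain ⟨m, hm⟩ : ∃ m, m + 1 = Nat.find hex := ⟨Nat.find hex - 1, by omega⟩
    refine lt_of_le_of_lt ?_ (h2 m hm)
    have : (2 : ℝ) ^ k ≤ 2 ^ m := pow_le_pow_right₀ one_le_two (by omega)
    linarith
  · left
    have h3 : (2 : ℝ) * 2 ^ Nat.find hex ≤ 2 ^ k := by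
      rw [← pow_succ']
      exact pow_le_pow_right₀ one_le_two h
    have : (0 : ℝ) < 2 ^ Nat.find hex := by positivity
    linarith

theorem chingSymbol_eq_of_forall_ne {A : Rn n → ℂ} {j : ℕ} {η : Rn n} (d : ℝ) (θ : Rn n)
    (h : ∀ k, k ≠ j → A (((2 : ℝ) ^ k)⁻¹ • η) = 0) (x : Rn n) :
    chingSymbol d θ A x η = (((2 : ℝ) ^ ((j : ℝ) * d) : ℝ) : ℂ) *
      expi (-((2 : ℝ) ^ j • θ)) x * A (((2 : ℝ) ^ j)⁻¹ • η) :=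
  tsum_eq_single j fun k hk => by rw [h k hk, mul_zero]

/-- Locally a single term survives, and `1 + |η|` is comparable to `2^j` on its support. Each
`x`-derivative costs `2^j` and each `η`-derivative gains `2^{-j}`, which gives `2^{j(d-k+l)}`. -/
theorem isSymbol11_chingSymbol (d : ℝ) (θ : Rn n) {A : Rn n → ℂ} (hAs : ContDiff ℝ ∞ A)
    (hAc : HasCompactSupport A) (hA : ∀ η, A η ≠ 0 → 3 / 4 ≤ ‖η‖ ∧ ‖η‖ ≤ 5 / 4) :
    IsSymbol11 d (chingSymbol d θ A) where
  smooth := by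
    rw [contDiff_iff_contDiffAt]
    rintro ⟨x₀, η₀⟩
    obtain ⟨j, hj⟩ := exists_eventually_forall_ne_eq_zero hA η₀
    have h1 : ContDiff ℝ ∞ fun p : Rn n × Rn n => (((2 : ℝ) ^ ((j : ℝ) * d) : ℝ) : ℂ) *
        expi (-((2 : ℝ) ^ j • θ)) p.1 * A (((2 : ℝ) ^ j)⁻¹ • p.2) :=
      (contDiff_const.mul ((contDiff_expi _).comp contDiff_fst)).mul
        (hAs.comp (contDiff_snd.const_smul _))
    refine h1.contDiffAt.congr_of_eventuallyEq ?_
    filter_upwards [(continuous_snd.tendsto (x₀, η₀)).eventually hj] with p hp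
    exact chingSymbol_eq_of_forall_ne d θ hp p.1
  bound k l := by
    set AS : 𝓢(Rn n, ℂ) := hAc.toSchwartzMap hAs with hAS
    set t : ℝ := d - k + l with ht
    -- From `3/4·2^j ≤ |η| ≤ 5/4·2^j` and `2^j ≥ 1` follows `4/9·(1+|η|) ≤ 2^j ≤ 4/3·(1+|η|)`.
    refine ⟨SchwartzMap.seminorm ℝ 0 k AS * ‖θ‖ ^ l * ((4 / 9) ^ t + (4 / 3) ^ t), fun x η => ?_⟩
    obtain ⟨j, hj⟩ := exists_eventually_forall_ne_eq_zero hA η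
    set T := (((2 : ℝ) ^ ((j : ℝ) * d) : ℝ) : ℂ) • iteratedFDeriv ℝ l (expi (-((2 : ℝ) ^ j • θ))) x
      with hT
    -- Near `η` the `x`-derivative is a scalar function of `η` times the fixed tensor `T`, so the
    -- `η`-derivatives fall on `A` alone.
    let L : ℂ →L[ℝ] (Rn n [×l]→L[ℝ] ℂ) :=
      (ContinuousLinearMap.toSpanSingleton ℂ T).restrictScalars ℝ
    have hAj : ContDiff ℝ ∞ fun η' : Rn n => A (((2 : ℝ) ^ j)⁻¹ • η') :=
      hAs.comp (contDiff_id.const_smul _)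
    have h1 : (fun η' => iteratedFDeriv ℝ l (fun x' => chingSymbol d θ A x' η') x) =ᶠ[𝓝 η]
        L ∘ fun η' => A (((2 : ℝ) ^ j)⁻¹ • η') := by
      filter_upwards [hj] with η' hη'
      have h2 : (fun x' => chingSymbol d θ A x' η') = fun x' =>
          (A (((2 : ℝ) ^ j)⁻¹ • η') * (((2 : ℝ) ^ ((j : ℝ) * d) : ℝ) : ℂ)) •
            expi (-((2 : ℝ) ^ j • θ)) x' := by
        funext x'
        rw [chingSymbol_eq_of_forall_ne d θ hη', smul_eq_mul]
        ring
      rw [h2, iteratedFDeriv_const_smul_apply'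
        ((contDiff_expi _).of_le (by exact_mod_cast le_top)).contDiffAt]
      change _ = A (((2 : ℝ) ^ j)⁻¹ • η') • T
      rw [hT, smul_smul]
    have hLn : ‖L‖ ≤ ‖T‖ := by
      refine L.opNorm_le_bound (norm_nonneg _) fun c => ?_
      simp [L, norm_smul, mul_comm]
    have hTn : ‖T‖ ≤ (2 : ℝ) ^ ((j : ℝ) * d) * (2 ^ j * ‖θ‖) ^ l := by
      rw [hT, norm_smul, Complex.norm_real, Real.norm_of_nonneg (by positivity)]
      gcongr
      refine (norm_iteratedFDeriv_expi_le _ _ _).trans_eq ?_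
      rw [norm_neg, norm_smul, Real.norm_of_nonneg (by positivity)]
    rw [(h1.iteratedFDeriv ℝ k).eq_of_nhds,
      L.iteratedFDeriv_comp_left hAj.contDiffAt (by exact_mod_cast le_top)]
    refine (ContinuousLinearMap.norm_compContinuousMultilinearMap_le _ _).trans ?_
    have hcomp := congrFun (iteratedFDeriv_comp_const_smul (𝕜 := ℝ) (i := k) ((2 : ℝ) ^ j)⁻¹
      (hAs.of_le (by exact_mod_cast le_top))) η
    rw [hcomp, norm_smul, norm_pow, norm_inv,
      Real.norm_of_nonneg (by positivity)]
    have hC : 0 ≤ SchwartzMap.seminorm ℝ 0 k AS := apply_nonneg _ _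
    by_cases h0 : iteratedFDeriv ℝ k A (((2 : ℝ) ^ j)⁻¹ • η) = 0
    · rw [h0, norm_zero, mul_zero, mul_zero]
      positivity
    have h3 : ((2 : ℝ) ^ j)⁻¹ • η ∈ {y : Rn n | 3 / 4 ≤ ‖y‖ ∧ ‖y‖ ≤ 5 / 4} :=
      closure_minimal (fun y hy => hA y hy) ((isClosed_le continuous_const continuous_norm).inter
        (isClosed_le continuous_norm continuous_const)) (support_iteratedFDeriv_subset k h0)
    rw [Set.mem_ofPred_eq, norm_smul, norm_inv, Real.norm_of_nonneg (by positivity),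
      inv_mul_le_iff₀ (by positivity), le_inv_mul_iff₀ (by positivity)] at h3
    have h4 : (1 : ℝ) ≤ 2 ^ j := one_le_pow₀ one_le_two
    have h5 := rpow_le_of_comparable (a := 4 / 9) (b := 4 / 3) (x := 1 + ‖η‖) (y := 2 ^ j)
      (by norm_num) (by positivity) (by linarith) (by linarith) t
    have h6 : ((2 : ℝ) ^ j) ^ t = 2 ^ ((j : ℝ) * d) * (((2 : ℝ) ^ j)⁻¹) ^ k * (2 ^ j) ^ l := by
      rw [ht, Real.rpow_add (by positivity), Real.rpow_sub (by positivity), Real.rpow_natCast,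
        Real.rpow_natCast, inv_pow, ← Real.rpow_natCast 2 j, ← Real.rpow_mul two_pos.le]
      rfl
    calc ‖L‖ * ((((2 : ℝ) ^ j)⁻¹) ^ k * ‖iteratedFDeriv ℝ k A (((2 : ℝ) ^ j)⁻¹ • η)‖)
        ≤ ((2 : ℝ) ^ ((j : ℝ) * d) * (2 ^ j * ‖θ‖) ^ l) *
          ((((2 : ℝ) ^ j)⁻¹) ^ k * SchwartzMap.seminorm ℝ 0 k AS) := by
          gcongr
          · exact hLn.trans hTn
          · exact SchwartzMap.norm_iteratedFDeriv_le_seminorm ℝ AS k _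
      _ = SchwartzMap.seminorm ℝ 0 k AS * ‖θ‖ ^ l * ((2 : ℝ) ^ j) ^ t := by rw [h6]; ring
      _ ≤ SchwartzMap.seminorm ℝ 0 k AS * ‖θ‖ ^ l *
        (((4 / 9) ^ t + (4 / 3) ^ t) * (1 + ‖η‖) ^ t) := by
          gcongr
      _ = _ := by ring

/-! ### Sobolev regularity -/

theorem hasSum_wTermDist_apply (d : ℝ) {θ : Rn n} (hθ : ‖θ‖ = 1) (v φ : 𝓢(Rn n, ℂ)) :
    HasSum (fun j => wTermDist d θ v j φ) (wDist d θ v φ) := by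
  obtain ⟨M, hM⟩ := exists_nat_one_le_add d
  have h := (summable_dyadicCoeff_mul hM
    (two_pow_mul_norm_apply_le hθ M (fourierS (mulS v φ)))).hasSum
  rw [← wDist_apply d hθ] at h
  simpa only [wTermDist_apply] using h

theorem fourierS_wTerm (d : ℝ) (θ : Rn n) (v : 𝓢(Rn n, ℂ)) (j : ℕ) (η : Rn n) :
    fourierS (wTerm d θ v j) η = dyadicCoeff d j * fourierS v (η - (2 : ℝ) ^ j • θ) := by
  rw [wTerm_eq, map_smul, smul_apply, fourierS_modulate, smul_eq_mul]

/-- The Fourier transform of the `j`-th term of `w(θ, d)` in Mathlib's normalization. -/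
noncomputable def wFourier (d : ℝ) (θ : Rn n) (v : 𝓢(Rn n, ℂ)) (j : ℕ) : 𝓢(Rn n, ℂ) :=
  FourierTransform.fourier (wTerm d θ v j)

theorem norm_le_of_fourierS_ne_zero {v : 𝓢(Rn n, ℂ)}
    (hv : tsupport (fourierS v) ⊆ Metric.closedBall (0 : Rn n) (1 / 20)) {η : Rn n}
    (h : fourierS v η ≠ 0) : ‖η‖ ≤ 1 / 20 := by
  simpa using hv (subset_tsupport _ h)

theorem norm_sub_le_of_wFourier_ne_zero {d : ℝ} {θ : Rn n} {v : 𝓢(Rn n, ℂ)}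
    (hv : tsupport (fourierS v) ⊆ Metric.closedBall (0 : Rn n) (1 / 20)) {j : ℕ} {ξ : Rn n}
    (h : wFourier d θ v j ξ ≠ 0) : ‖(2 * Real.pi) • ξ - (2 : ℝ) ^ j • θ‖ ≤ 1 / 20 := by
  rw [wFourier, fourier_eq_fourierS, fourierS_wTerm] at h
  exact norm_le_of_fourierS_ne_zero hv (right_ne_zero_of_mul h)

theorem wFourier_eq_zero_or {d : ℝ} {θ : Rn n} (hθ : ‖θ‖ = 1) {v : 𝓢(Rn n, ℂ)}
    (hv : tsupport (fourierS v) ⊆ Metric.closedBall (0 : Rn n) (1 / 20)) {j k : ℕ} (hjk : j ≠ k)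
    (ξ : Rn n) : wFourier d θ v j ξ = 0 ∨ wFourier d θ v k ξ = 0 := by
  by_contra! h
  have h1 := norm_sub_le_of_wFourier_ne_zero hv h.1
  have h2 := norm_sub_le_of_wFourier_ne_zero hv h.2
  have h3 := (norm_add_two_pow_smul_sub_ge hθ (ζ := 0) hjk (by simp)).2
  have h4 : (1 : ℝ) ≤ 2 ^ k := one_le_pow₀ one_le_two
  have h5 : (0 : Rn n) + (2 : ℝ) ^ k • θ - (2 : ℝ) ^ j • θ =
      ((2 * Real.pi) • ξ - (2 : ℝ) ^ j • θ) - ((2 * Real.pi) • ξ - (2 : ℝ) ^ k • θ) := by abel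
  rw [h5] at h3
  have h6 := norm_sub_le ((2 * Real.pi) • ξ - (2 : ℝ) ^ j • θ)
    ((2 * Real.pi) • ξ - (2 : ℝ) ^ k • θ)
  linarith

theorem exists_one_add_norm_sq_rpow_le (s : ℝ) : ∃ K : ℝ, 0 ≤ K ∧ ∀ (d : ℝ) (θ : Rn n),
    ‖θ‖ = 1 → ∀ v : 𝓢(Rn n, ℂ), tsupport (fourierS v) ⊆ Metric.closedBall (0 : Rn n) (1 / 20) →
      ∀ (j : ℕ) (ξ : Rn n), wFourier d θ v j ξ ≠ 0 →
        (1 + ‖ξ‖ ^ 2) ^ (s / 2) ≤ K * 2 ^ ((j : ℝ) * s) := by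
  -- Since `2π|ξ|` is within `1/20` of `2^j` and `3 < π ≤ 4`, one has `|ξ| ≤ 2^j ≤ 16|ξ|`, so `1 +
  -- |ξ|²` lies between `4^j/256` and `2·4^j`.
  refine ⟨(1 / 256) ^ (s / 2) + 2 ^ (s / 2), by positivity, fun d θ hθ v hv j ξ h => ?_⟩
  have h1 := norm_sub_le_of_wFourier_ne_zero hv h
  have h2 : ‖(2 * Real.pi) • ξ‖ = 2 * Real.pi * ‖ξ‖ := by
    rw [norm_smul, Real.norm_of_nonneg (by positivity)]
  have h3 := norm_sub_norm_le ((2 * Real.pi) • ξ) ((2 : ℝ) ^ j • θ)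
  have h4 := norm_sub_norm_le ((2 : ℝ) ^ j • θ) ((2 * Real.pi) • ξ)
  rw [norm_sub_rev] at h4
  rw [h2, norm_two_pow_smul hθ] at h3 h4
  have h5 : (1 : ℝ) ≤ 2 ^ j := one_le_pow₀ one_le_two
  have h6 := Real.pi_gt_three
  have h7 := Real.pi_le_four
  have h8 := norm_nonneg ξ
  have h9 : ‖ξ‖ ≤ 2 ^ j := by nlinarith
  have h10 : 2 ^ j ≤ 16 * ‖ξ‖ := by nlinarith
  have h11 : ((2 : ℝ) ^ ((j : ℝ) * s)) = (((2 : ℝ) ^ j) ^ 2) ^ (s / 2) := by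
    rw [← Real.rpow_natCast 2 j, ← Real.rpow_natCast _ 2, ← Real.rpow_mul two_pos.le,
      ← Real.rpow_mul two_pos.le]
    congr 1
    push_cast
    ring
  rw [h11]
  exact rpow_le_of_comparable (by norm_num) (by positivity) (by nlinarith) (by nlinarith) _

theorem norm_toLp_wTerm (d : ℝ) (θ : Rn n) (v : 𝓢(Rn n, ℂ)) (j : ℕ) :
    ‖(wTerm d θ v j).toLp 2‖ = 2 ^ (-((j : ℝ) * d)) * ‖v.toLp 2‖ := by
  rw [wTerm_eq]
  have h1 : (dyadicCoeff d j • modulate ((2 : ℝ) ^ j • θ) v).toLp 2 =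
      dyadicCoeff d j • (modulate ((2 : ℝ) ^ j • θ) v).toLp 2 := rfl
  rw [h1, norm_smul, norm_dyadicCoeff, SchwartzMap.norm_toLp, SchwartzMap.norm_toLp]
  congr 2
  exact eLpNorm_congr_norm_ae (.of_forall fun x => by simp)

theorem norm_toLp_wFourier (d : ℝ) (θ : Rn n) (v : 𝓢(Rn n, ℂ)) (j : ℕ) :
    ‖(wFourier d θ v j).toLp 2‖ = 2 ^ (-((j : ℝ) * d)) * ‖v.toLp 2‖ := by
  rw [wFourier, SchwartzMap.norm_fourier_toL2_eq, norm_toLp_wTerm]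

/-- The Bessel weight `(1 + |ξ|²)^{s/2}`. -/
noncomputable def besselWeight (s : ℝ) (ξ : Rn n) : ℂ := ((1 + ‖ξ‖ ^ 2) ^ (s / 2) : ℝ)

theorem hasTemperateGrowth_besselWeight (s : ℝ) :
    (besselWeight s : Rn n → ℂ).HasTemperateGrowth := by
  unfold besselWeight
  fun_prop

theorem besselWeight_mul_neg (s : ℝ) (ξ : Rn n) : besselWeight s ξ * besselWeight (-s) ξ = 1 := by
  rw [besselWeight, besselWeight, ← Complex.ofReal_mul, ← Real.rpow_add (by positivity)]
  simp [neg_div]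

/-- The Fourier transform of the `j`-th term of `w(θ, d)`, multiplied by a Bessel weight. -/
noncomputable def wWeighted (s d : ℝ) (θ : Rn n) (v : 𝓢(Rn n, ℂ)) (j : ℕ) : 𝓢(Rn n, ℂ) :=
  SchwartzMap.smulLeftCLM ℂ (besselWeight s) (wFourier d θ v j)

theorem wWeighted_apply (s d : ℝ) (θ : Rn n) (v : 𝓢(Rn n, ℂ)) (j : ℕ) (ξ : Rn n) :
    wWeighted s d θ v j ξ = besselWeight s ξ * wFourier d θ v j ξ := by
  simp [wWeighted, SchwartzMap.smulLeftCLM_apply_apply (hasTemperateGrowth_besselWeight s)]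

theorem exists_norm_toLp_wWeighted_le (s d : ℝ) {θ : Rn n} (hθ : ‖θ‖ = 1) {v : 𝓢(Rn n, ℂ)}
    (hv : tsupport (fourierS v) ⊆ Metric.closedBall (0 : Rn n) (1 / 20)) :
    ∃ K : ℝ, 0 ≤ K ∧ ∀ j, ‖(wWeighted s d θ v j).toLp 2‖ ≤
      K * 2 ^ ((j : ℝ) * s) * 2 ^ (-((j : ℝ) * d)) := by
  obtain ⟨K, hK0, hK⟩ := exists_one_add_norm_sq_rpow_le (n := n) s
  refine ⟨K * ‖v.toLp 2‖, by positivity, fun j => ?_⟩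
  have h : ‖(wWeighted s d θ v j).toLp 2‖ ≤
      (K * 2 ^ ((j : ℝ) * s)) * ‖(wFourier d θ v j).toLp 2‖ := by
    refine Lp.norm_le_mul_norm_of_ae_le_mul ?_
    filter_upwards [(wWeighted s d θ v j).coeFn_toLp 2, (wFourier d θ v j).coeFn_toLp 2]
      with ξ h1 h2
    rw [h1, h2, wWeighted_apply, norm_mul]
    by_cases h0 : wFourier d θ v j ξ = 0
    · simp [h0]
    · gcongr
      rw [besselWeight, Complex.norm_real, Real.norm_of_nonneg (by positivity)]
      exact hK d θ hθ v hv j ξ h0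
  rw [norm_toLp_wFourier] at h
  calc _ ≤ _ := h
    _ = _ := by ring

theorem smulLeftCLM_fourier_wTermDist (s d : ℝ) (θ : Rn n) (v : 𝓢(Rn n, ℂ)) (j : ℕ) :
    TemperedDistribution.smulLeftCLM ℂ (besselWeight s)
      (FourierTransform.fourier (wTermDist d θ v j)) =
      (((wWeighted s d θ v (j + 1)).toLp 2 : Lp ℂ 2 (volume : Measure (Rn n))) : 𝓢'(Rn n, ℂ)) := by
  rw [wTermDist, TemperedDistribution.fourier_toTemperedDistributionCLM_eq,
    MeasureTheory.Lp.toTemperedDistribution_toLp_eq]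
  ext φ
  rw [TemperedDistribution.smulLeftCLM_apply_apply]
  refine (SchwartzMap.toTemperedDistributionCLM_apply_apply volume _ _).trans
    (Eq.trans ?_ (SchwartzMap.toTemperedDistributionCLM_apply_apply volume _ _).symm)
  refine integral_congr_ae (.of_forall fun ξ => ?_)
  simp only [wWeighted_apply, smul_eq_mul, wFourier,
    SchwartzMap.smulLeftCLM_apply_apply (hasTemperateGrowth_besselWeight s)]
  ring

/-- The weighted terms have `L²` norms `O(2^{j(s-d)})`, so their series converges absolutely in
`L²`; orthogonality is not needed in this direction. -/
theorem memSobolev_wDist {s d : ℝ} (hsd : s < d) {θ : Rn n} (hθ : ‖θ‖ = 1) {v : 𝓢(Rn n, ℂ)}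
    (hv : tsupport (fourierS v) ⊆ Metric.closedBall (0 : Rn n) (1 / 20)) :
    MemSobolev s 2 (wDist d θ v) := by
  obtain ⟨K, hK0, hK⟩ := exists_norm_toLp_wWeighted_le s d hθ hv
  have hlt : (2 : ℝ) ^ (s - d) < 1 := Real.rpow_lt_one_of_one_lt_of_neg one_lt_two (by linarith)
  have hsum : Summable fun j : ℕ => (wWeighted s d θ v (j + 1)).toLp 2 := by
    refine .of_norm_bounded (g := fun j : ℕ => K * ((2 : ℝ) ^ (s - d)) ^ (j + 1)) ?_ fun j => ?_
    · exact (((summable_geometric_of_lt_one (by positivity) hlt).comp_injective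
        (add_left_injective 1))).mul_left K
    · refine (hK (j + 1)).trans_eq ?_
      rw [mul_assoc, ← Real.rpow_add two_pos, ← Real.rpow_natCast, ← Real.rpow_mul two_pos.le]
      congr 2
      ring
  refine memSobolev_iff_exists_smulLeftCLM_fourier.2
    ⟨∑' j : ℕ, (wWeighted s d θ v (j + 1)).toLp 2, ?_⟩
  have h1 := hsum.hasSum.mapL (MeasureTheory.Lp.toTemperedDistributionCLM ℂ
    (volume : Measure (Rn n)) 2)
  have h2 := ((hasSum_wDist d hθ v).mapL (FourierTransform.fourierCLM ℂ 𝓢'(Rn n, ℂ))).mapL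
    (TemperedDistribution.smulLeftCLM ℂ (besselWeight s))
  refine h2.unique ?_
  convert h1 using 1
  · funext j
    exact smulLeftCLM_fourier_wTermDist s d θ v j
  · rfl

/-- By Bessel's inequality, a bounded orthogonal sequence converges weakly to zero. -/
theorem false_of_orthogonal_inner_eq {H : Type*} [NormedAddCommGroup H] [InnerProductSpace ℂ H]
    {ψ : ℕ → H} {x : H} {B : ℝ} {c : ℂ} (hc : c ≠ 0) (hψ : ∀ j k, j ≠ k → inner ℂ (ψ j) (ψ k) = 0)
    (hB : ∀ j, ‖ψ j‖ ≤ B) (hx : ∀ j, inner ℂ (ψ j) x = c) : False := by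
  have hpos : ∀ j, 0 < ‖ψ j‖ := fun j => norm_pos_iff.2 fun h =>
    hc (by rw [← hx j, h, inner_zero_left])
  have hon : Orthonormal ℂ fun j => ((‖ψ j‖⁻¹ : ℝ) : ℂ) • ψ j := by
    refine ⟨fun j => ?_, fun j k hjk => ?_⟩
    · rw [norm_smul, Complex.norm_real, Real.norm_of_nonneg (by positivity),
        inv_mul_cancel₀ (hpos j).ne']
    · simp only [inner_smul_left, inner_smul_right, hψ j k hjk, mul_zero]
  have h1 := (hon.inner_products_summable x).tendsto_atTop_zero
  have hBp : 0 < B := (hpos 0).trans_le (hB 0)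
  have h2 : ∀ j, (‖c‖ / B) ^ 2 ≤ ‖inner ℂ (((‖ψ j‖⁻¹ : ℝ) : ℂ) • ψ j) x‖ ^ 2 := by
    intro j
    rw [inner_smul_left, hx, norm_mul, RCLike.norm_conj, Complex.norm_real,
      Real.norm_of_nonneg (by positivity), div_eq_inv_mul]
    gcongr
    · exact hpos j
    · exact hB j
  have h3 := ge_of_tendsto' h1 h2
  have h4 : 0 < (‖c‖ / B) ^ 2 := by
    have := norm_pos_iff.2 hc
    positivity
  linarith

/-- The complex conjugate of a Schwartz function. -/
noncomputable def conjS (f : 𝓢(Rn n, ℂ)) : 𝓢(Rn n, ℂ) :=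
  SchwartzMap.postcompCLM (Complex.conjCLE : ℂ →L[ℝ] ℂ) f

@[simp] theorem conjS_apply (f : 𝓢(Rn n, ℂ)) (x : Rn n) :
    conjS f x = (starRingEnd ℂ) (f x) := rfl

/-- By Parseval the pairing is a sum of `L²` inner products with the chosen bump, and disjointness
of supports leaves only its own squared norm. -/
theorem wDist_fourier_conjS {d : ℝ} {θ : Rn n} (hθ : ‖θ‖ = 1) {v : 𝓢(Rn n, ℂ)}
    (hv : tsupport (fourierS v) ⊆ Metric.closedBall (0 : Rn n) (1 / 20)) (k : ℕ) :
    wDist d θ v (FourierTransform.fourier (conjS (wFourier d θ v (k + 1)))) =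
      (‖(wFourier d θ v (k + 1)).toLp 2‖ : ℂ) ^ 2 := by
  have h1 : ∀ j, wTermDist d θ v j (FourierTransform.fourier (conjS (wFourier d θ v (k + 1)))) =
      inner ℂ ((wFourier d θ v (k + 1)).toLp 2) ((wFourier d θ v (j + 1)).toLp 2) := by
    intro j
    rw [SchwartzMap.inner_toL2_toL2_eq _ _ volume]
    refine (SchwartzMap.toTemperedDistributionCLM_apply_apply volume _ _).trans ?_
    simp only [smul_eq_mul]
    rw [SchwartzMap.integral_fourier_mul_eq]
    refine integral_congr_ae (.of_forall fun ξ => ?_)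
    simp [wFourier, mul_comm]
  refine (hasSum_wTermDist_apply d hθ v _).unique ?_
  simp only [h1]
  have h2 := hasSum_single (f := fun j => inner ℂ ((wFourier d θ v (k + 1)).toLp 2)
    ((wFourier d θ v (j + 1)).toLp 2)) k fun j hj => ?_
  · rw [inner_self_eq_norm_sq_to_K] at h2
    exact h2
  · rw [SchwartzMap.inner_toL2_toL2_eq _ _ volume, ← integral_zero (Rn n) ℂ]
    refine integral_congr_ae (.of_forall fun ξ => ?_)
    rcases wFourier_eq_zero_or (d := d) hθ hv (fun h => hj (by omega) : j + 1 ≠ k + 1) ξ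
        with h | h <;>
      simp [h]

/-- Let `f ∈ L²` be the transform of `w` weighted to order `d`. The vectors `ψ_k = 4^{kd}
(1+|ξ|²)^{-d/2} ŵ_k` are orthogonal and bounded, yet `⟨ψ_k, f⟩ = 4^{kd} ‖ŵ_k‖² = ‖v‖²` for every `k
≥ 1`, which Bessel's inequality forbids. -/
theorem not_memSobolev_wDist (d : ℝ) {θ : Rn n} (hθ : ‖θ‖ = 1) {v : 𝓢(Rn n, ℂ)} (hv0 : v ≠ 0)
    (hv : tsupport (fourierS v) ⊆ Metric.closedBall (0 : Rn n) (1 / 20)) :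
    ¬ MemSobolev d 2 (wDist d θ v) := by
  intro h
  obtain ⟨f, hf⟩ := memSobolev_iff_exists_smulLeftCLM_fourier.1 h
  obtain ⟨K, hK0, hK⟩ := exists_norm_toLp_wWeighted_le (-d) d hθ hv
  let c : ℕ → ℂ := fun k => dyadicCoeff (-(2 * d)) k
  have hcn : ∀ k : ℕ, c k = ((2 ^ ((k : ℝ) * d) * 2 ^ ((k : ℝ) * d) : ℝ) : ℂ) := by
    intro k
    simp only [c, dyadicCoeff]
    rw [← Real.rpow_add two_pos]
    congr 2
    ring
  have hpow : ∀ k : ℕ, (2 : ℝ) ^ ((k : ℝ) * d) * 2 ^ (-((k : ℝ) * d)) = 1 := by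
    intro k
    rw [← Real.rpow_add two_pos, add_neg_cancel, Real.rpow_zero]
  have hvL : ‖v.toLp 2‖ ≠ 0 := by
    rw [norm_ne_zero_iff]
    intro h0
    exact hv0 (SchwartzMap.injective_toLp (F := ℂ) 2 (volume : Measure (Rn n)) (h0.trans rfl))
  refine false_of_orthogonal_inner_eq (B := K) (c := (‖v.toLp 2‖ : ℂ) ^ 2) (x := f)
    (ψ := fun k => c (k + 1) • (wWeighted (-d) d θ v (k + 1)).toLp 2)
    (pow_ne_zero _ (by exact_mod_cast hvL)) (fun j k hjk => ?_) (fun k => ?_) fun k => ?_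
  · rw [inner_smul_left, inner_smul_right, SchwartzMap.inner_toL2_toL2_eq _ _ volume]
    have : ∫ ξ, inner ℂ (wWeighted (-d) d θ v (j + 1) ξ) (wWeighted (-d) d θ v (k + 1) ξ) = 0 := by
      rw [← integral_zero (Rn n) ℂ]
      refine integral_congr_ae (.of_forall fun ξ => ?_)
      rcases wFourier_eq_zero_or (d := d) hθ hv (fun h => hjk (by omega) : j + 1 ≠ k + 1) ξ
          with h | h <;>
        simp [wWeighted_apply, h]
    rw [this, mul_zero, mul_zero]
  · rw [norm_smul, hcn, Complex.norm_real, Real.norm_of_nonneg (by positivity)]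
    calc _ ≤ 2 ^ (((k + 1 : ℕ) : ℝ) * d) * 2 ^ (((k + 1 : ℕ) : ℝ) * d) *
          (K * 2 ^ (((k + 1 : ℕ) : ℝ) * -d) * 2 ^ (-(((k + 1 : ℕ) : ℝ) * d))) := by
          gcongr
          exact hK (k + 1)
      _ = K * (2 ^ (((k + 1 : ℕ) : ℝ) * d) * 2 ^ (-(((k + 1 : ℕ) : ℝ) * d))) *
          (2 ^ (((k + 1 : ℕ) : ℝ) * d) * 2 ^ (-(((k + 1 : ℕ) : ℝ) * d))) := by
          rw [mul_neg]
          ring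
      _ = K := by rw [hpow, mul_one, mul_one]
  · have h1 : inner ℂ ((wWeighted (-d) d θ v (k + 1)).toLp 2) f =
        wDist d θ v (FourierTransform.fourier (conjS (wFourier d θ v (k + 1)))) := by
      have h2 := congrArg (fun u : 𝓢'(Rn n, ℂ) => u (conjS (wWeighted (-d) d θ v (k + 1)))) hf
      simp only [Lp.toTemperedDistribution_apply] at h2
      rw [L2.inner_def]
      refine Eq.trans ?_ (h2.symm.trans ?_)
      · refine integral_congr_ae ?_
        filter_upwards [(wWeighted (-d) d θ v (k + 1)).coeFn_toLp 2] with ξ hξ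
        rw [hξ]
        simp [mul_comm]
      · change wDist d θ v (FourierTransform.fourier
          (SchwartzMap.smulLeftCLM ℂ (besselWeight d) (conjS (wWeighted (-d) d θ v (k + 1))))) = _
        congr 2
        ext ξ
        rw [SchwartzMap.smulLeftCLM_apply_apply (hasTemperateGrowth_besselWeight d), conjS_apply,
          wWeighted_apply, map_mul, smul_eq_mul, ← mul_assoc]
        have h3 : (starRingEnd ℂ) (besselWeight (-d) ξ) = besselWeight (-d) ξ :=
          Complex.conj_ofReal _
        rw [h3, besselWeight_mul_neg, one_mul, conjS_apply]
    rw [inner_smul_left, h1, wDist_fourier_conjS hθ hv, norm_toLp_wFourier, hcn,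
      Complex.conj_ofReal]
    have h4 := hpow (k + 1)
    norm_cast
    linear_combination (‖v.toLp 2‖ ^ 2 *
      (2 ^ (((k + 1 : ℕ) : ℝ) * d) * 2 ^ (-(((k + 1 : ℕ) : ℝ) * d)) + 1)) * h4

theorem memSobolev_wDist_iff (s d : ℝ) {θ : Rn n} (hθ : ‖θ‖ = 1) {v : 𝓢(Rn n, ℂ)} (hv0 : v ≠ 0)
    (hv : tsupport (fourierS v) ⊆ Metric.closedBall (0 : Rn n) (1 / 20)) :
    MemSobolev s 2 (wDist d θ v) ↔ s < d := by
  refine ⟨fun h => ?_, fun h => memSobolev_wDist h hθ hv⟩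
  by_contra! hsd
  exact not_memSobolev_wDist d hθ hv0 hv (h.mono hsd)

/-! ### Convolution and reflection -/

/-- The reflection `f ↦ f(-·)` on Schwartz functions. -/
noncomputable def reflectS : 𝓢(Rn n, ℂ) →L[ℂ] 𝓢(Rn n, ℂ) :=
  SchwartzMap.compCLMOfContinuousLinearEquiv ℂ (ContinuousLinearEquiv.neg ℝ : Rn n ≃L[ℝ] Rn n)

@[simp] theorem reflectS_apply (f : 𝓢(Rn n, ℂ)) (x : Rn n) : reflectS f x = f (-x) := rfl

theorem fourierS_reflectS (f : 𝓢(Rn n, ℂ)) (x : Rn n) :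
    fourierS (reflectS f) x = fourierS f (-x) := by
  rw [fourierS_apply, fourierS_apply,
    ← integral_neg_eq_self (fun y => expi (-x) (-y) * f y)]
  refine integral_congr_ae (.of_forall fun y => ?_)
  simp only [reflectS_apply, expi_neg_left, neg_neg]

theorem two_pi_pow_ne_zero (n : ℕ) : ((2 * Real.pi : ℝ) : ℂ) ^ n ≠ 0 := by
  have := Real.pi_pos
  exact pow_ne_zero _ (by exact_mod_cast (by positivity : (2 * Real.pi : ℝ) ≠ 0))

theorem reflectS_fourierS_modulate (φ : 𝓢(Rn n, ℂ)) (a η : Rn n) :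
    reflectS (fourierS (modulate (-a) φ)) η = fourierS φ (a - η) := by
  rw [reflectS_apply, fourierS_modulate]
  congr 1
  abel

/-- This convolution theorem follows from the multiplication formula and inversion, because `φ̂(ξ -
·)` is itself a reflected Fourier transform. -/
theorem integral_fourierS_mul_fourierS_sub (v φ : 𝓢(Rn n, ℂ)) (ξ : Rn n) :
    ((2 * Real.pi : ℝ) : ℂ)⁻¹ ^ n * ∫ ζ, fourierS v ζ * fourierS φ (ξ - ζ) =
      fourierS (mulS v φ) ξ := by
  simp only [← reflectS_fourierS_modulate]
  rw [integral_fourierS_mul, fourierS_apply, inv_pow, inv_mul_eq_iff_eq_mul₀ (two_pi_pow_ne_zero n),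
    ← integral_const_mul]
  refine integral_congr_ae (.of_forall fun x => ?_)
  simp only [fourierS_reflectS, fourierS_fourierS, neg_neg, modulate_apply, mulS_apply,
    expi_neg_left]
  ring

/-! ### Frequency modulation of Ching's symbol -/

section

variable {d : ℝ} {σ : Rn n} {A : Rn n → ℂ}

theorem two_rpow_eq_dyadicCoeff (d : ℝ) (j : ℕ) :
    (((2 : ℝ) ^ ((j : ℝ) * d) : ℝ) : ℂ) = dyadicCoeff (-d) j := by
  rw [dyadicCoeff, mul_neg, neg_neg]

/-- For fixed `η` the symbol is a multiple of one exponential in `x`, whose transform is a point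
mass at `-2^j σ`; the frequency cut-off just multiplies by its value there. -/
theorem freqCut_chingSymbol (ha : IsSymbol11 d (chingSymbol d σ A)) (ψ : TestFn n) (m : ℕ)
    {j : ℕ} {η : Rn n} (h : ∀ k, k ≠ j → A (((2 : ℝ) ^ k)⁻¹ • η) = 0) (x : Rn n) :
    ha.freqCut ψ m x η = dyadicCoeff (-d) j * A (((2 : ℝ) ^ j)⁻¹ • η) *
      ψ.dilate m (-((2 : ℝ) ^ j • σ)) * expi (-((2 : ℝ) ^ j • σ)) x := by
  set Ψ := TestFn.toSchwartz ((ψ.dilate m).mulSmooth (expi x) (contDiff_expi x)) with hΨ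
  have h1 : fourierS' (ha.slice η) Ψ = (dyadicCoeff (-d) j * A (((2 : ℝ) ^ j)⁻¹ • η)) *
      fourierS (fourierS Ψ) ((2 : ℝ) ^ j • σ) := by
    rw [fourierS'_apply, IsSymbol11.slice,
      Function.HasTemperateGrowth.toTemperedDistribution_apply volume,
      fourierS_apply, ← integral_const_mul]
    refine integral_congr_ae (.of_forall fun y => ?_)
    simp only [chingSymbol_eq_of_forall_ne d σ h, two_rpow_eq_dyadicCoeff, smul_eq_mul,
      expi_neg_left]
    ring
  rw [IsSymbol11.freqCut, h1, fourierS_fourierS, hΨ, TestFn.toSchwartz_apply,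
    TestFn.mulSmooth_apply, expi_comm x, inv_pow]
  field_simp [two_pi_pow_ne_zero n]

/-- The Schwartz function `η ↦ A(2^{-j}η) ψ(2^{-m}η)`. -/
noncomputable def cutoffS (hAs : ContDiff ℝ ∞ A) (ψ : TestFn n) (m j : ℕ) : 𝓢(Rn n, ℂ) :=
  TestFn.toSchwartz ((ψ.dilate m).mulSmooth (fun η => A (((2 : ℝ) ^ j)⁻¹ • η))
    (hAs.comp (contDiff_id.const_smul _)))

/-- The transpose of `OP(a^m(x, η) ψ(2^{-m}η))`, with the first `J` terms of Ching's symbol `a`,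
on the Fourier side. -/
noncomputable def chingTranspose (d : ℝ) (σ : Rn n) (hAs : ContDiff ℝ ∞ A) (ψ : TestFn n)
    (m J : ℕ) : 𝓢(Rn n, ℂ) →L[ℂ] 𝓢(Rn n, ℂ) :=
  ∑ j ∈ Finset.range J, (((2 * Real.pi : ℝ) : ℂ)⁻¹ ^ n * dyadicCoeff (-d) j *
    ψ.dilate m (-((2 : ℝ) ^ j • σ))) • (mulS (cutoffS hAs ψ m j)).comp
      (reflectS.comp (fourierS.comp (modulate (-((2 : ℝ) ^ j • σ)))))

theorem chingTranspose_apply (hAs : ContDiff ℝ ∞ A) (ψ : TestFn n) {m J : ℕ}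
    (hJ : ∀ j, J ≤ j → ψ.dilate m (-((2 : ℝ) ^ j • σ)) = 0) (φ : 𝓢(Rn n, ℂ)) {j : ℕ} {η : Rn n}
    (h : ∀ k, k ≠ j → A (((2 : ℝ) ^ k)⁻¹ • η) = 0) :
    chingTranspose d σ hAs ψ m J φ η = ((2 * Real.pi : ℝ) : ℂ)⁻¹ ^ n * (dyadicCoeff (-d) j *
      A (((2 : ℝ) ^ j)⁻¹ • η) * ψ.dilate m (-((2 : ℝ) ^ j • σ)) * ψ.dilate m η *
      fourierS φ ((2 : ℝ) ^ j • σ - η)) := by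
  have h1 : chingTranspose d σ hAs ψ m J φ η = ∑ k ∈ Finset.range J,
      ((2 * Real.pi : ℝ) : ℂ)⁻¹ ^ n * (dyadicCoeff (-d) k *
      A (((2 : ℝ) ^ k)⁻¹ • η) * ψ.dilate m (-((2 : ℝ) ^ k • σ)) * ψ.dilate m η *
      fourierS φ ((2 : ℝ) ^ k • σ - η)) := by
    rw [chingTranspose, sum_apply, sum_apply]
    refine Finset.sum_congr rfl fun k _ => ?_
    rw [smul_apply, smul_apply, ContinuousLinearMap.comp_apply, ContinuousLinearMap.comp_apply,
      ContinuousLinearMap.comp_apply, mulS_apply, reflectS_fourierS_modulate, cutoffS,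
      TestFn.toSchwartz_apply, TestFn.mulSmooth_apply, smul_eq_mul]
    ring
  rw [h1]
  -- When the surviving index is not below `J`, its term vanishes by `hJ`, so the truncation loses
  -- nothing.
  refine Finset.sum_eq_single j (fun k _ hk => by rw [h k hk]; ring) fun hj => ?_
  rw [hJ j (by simpa using hj)]
  ring

/-- Compact support of `ψ` leaves only finitely many symbol terms for each `m`, so the transpose is
a finite sum of continuous maps. -/
theorem exists_forall_dilate_eq_zero (hσ : σ ≠ 0) (ψ : TestFn n) (m : ℕ) :
    ∃ J : ℕ, ∀ j, J ≤ j → ψ.dilate m (-((2 : ℝ) ^ j • σ)) = 0 := by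
  obtain ⟨R, hR⟩ := (ψ.dilate m).hasCompactSupport.isCompact.isBounded.exists_norm_le
  obtain ⟨J, hJ⟩ := pow_unbounded_of_one_lt (R / ‖σ‖) one_lt_two
  refine ⟨J, fun j hj => ?_⟩
  by_contra h0
  have h1 := hR _ (subset_tsupport _ h0)
  rw [norm_neg, norm_smul, Real.norm_of_nonneg (by positivity)] at h1
  have h2 : (2 : ℝ) ^ J ≤ 2 ^ j := pow_le_pow_right₀ one_le_two hj
  have h3 := norm_pos_iff.2 hσ
  rw [div_lt_iff₀ h3] at hJ
  nlinarith

theorem isOP_chingTranspose (ha : IsSymbol11 d (chingSymbol d σ A)) (hAs : ContDiff ℝ ∞ A)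
    (hA : ∀ η, A η ≠ 0 → 3 / 4 ≤ ‖η‖ ∧ ‖η‖ ≤ 5 / 4) (ψ : TestFn n) {m J : ℕ}
    (hJ : ∀ j, J ≤ j → ψ.dilate m (-((2 : ℝ) ^ j • σ)) = 0) (u : 𝓢'(Rn n, ℂ)) :
    IsOP (fun x η => ha.freqCut ψ m x η * ψ (((2 : ℝ) ^ m)⁻¹ • η)) u
      (PointwiseConvergenceCLM.precomp ℂ (chingTranspose d σ hAs ψ m J) (fourierS' u)) := by
  intro φ
  refine ⟨chingTranspose d σ hAs ψ m J φ, fun η => ?_, rfl⟩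
  obtain ⟨j, hj⟩ := exists_eventually_forall_ne_eq_zero hA η
  have hj := hj.self_of_nhds
  rw [chingTranspose_apply hAs ψ hJ φ hj, fourierS_apply, ← integral_const_mul]
  congr 1
  refine integral_congr_ae (.of_forall fun x => ?_)
  simp only [freqCut_chingSymbol ha ψ m hj, TestFn.dilate_apply]
  rw [sub_eq_add_neg ((2 : ℝ) ^ j • σ), expi_add, expi_neg_left η, neg_neg,
    expi_neg_left ((2 : ℝ) ^ j • σ)]
  ring

end

/-! ### The action of Ching's operator -/

theorem wTermDist_fourierS (d : ℝ) (θ : Rn n) (v g : 𝓢(Rn n, ℂ)) (k : ℕ) :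
    wTermDist d θ v k (fourierS g) = dyadicCoeff d (k + 1) *
      ∫ ζ, fourierS v ζ * g (ζ + (2 : ℝ) ^ (k + 1) • θ) := by
  refine (SchwartzMap.toTemperedDistributionCLM_apply_apply volume _ _).trans ?_
  simp only [smul_eq_mul]
  rw [integral_fourierS_mul, ← integral_const_mul,
    ← integral_add_right_eq_self _ ((2 : ℝ) ^ (k + 1) • θ)]
  refine integral_congr_ae (.of_forall fun ζ => ?_)
  simp only [fourierS_wTerm, add_sub_cancel_right]
  ring

theorem norm_add_two_pow_smul_bounds {θ ζ : Rn n} (hθ : ‖θ‖ = 1) (hζ : ‖ζ‖ ≤ 1 / 20) (k : ℕ) :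
    2 ^ k - 1 / 20 ≤ ‖ζ + (2 : ℝ) ^ k • θ‖ ∧ ‖ζ + (2 : ℝ) ^ k • θ‖ ≤ 2 ^ k + 1 / 20 := by
  have h1 := norm_add_le ζ ((2 : ℝ) ^ k • θ)
  have h2 := norm_sub_le (ζ + (2 : ℝ) ^ k • θ) ζ
  rw [add_sub_cancel_left] at h2
  rw [norm_two_pow_smul hθ] at h1 h2
  constructor <;> linarith

theorem tendsto_dilate {ψ : TestFn n} (hψ : IsModulation ψ) (ξ : Rn n) :
    Tendsto (fun m => ψ.dilate m ξ) atTop (𝓝 1) := by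
  have h1 : Tendsto (fun m : ℕ => ((2 : ℝ) ^ m)⁻¹ • ξ) atTop (𝓝 0) := by
    simpa using (tendsto_inv_atTop_zero.comp
      (tendsto_pow_atTop_atTop_of_one_lt (one_lt_two (α := ℝ)))).smul_const ξ
  exact tendsto_const_nhds.congr' ((h1.eventually hψ).mono fun m hm => hm.symm)

theorem TestFn.exists_norm_dilate_le (ψ : TestFn n) :
    ∃ B : ℝ, 0 ≤ B ∧ ∀ m ξ, ‖ψ.dilate m ξ‖ ≤ B :=
  ⟨SchwartzMap.seminorm ℂ 0 0 (TestFn.toSchwartz ψ), apply_nonneg _ _, fun _ _ =>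
    SchwartzMap.norm_le_seminorm ℂ (TestFn.toSchwartz ψ) _⟩

section

variable {d : ℝ} {θ : Rn n} {v : 𝓢(Rn n, ℂ)} {A : Rn n → ℂ}

/-- The bump lies within `1/20` of `2^{k+1} θ`, hence in the plateau of `A(2^{-(k+1)}·)` and off the
other annuli. The coefficients `2^{±(k+1)d}` cancel, and `2^{k+1}·2θ - (ζ + 2^{k+1} θ) = 2^{k+1} θ -
ζ` reverses the frequency. -/
theorem wTermDist_fourierS_chingTranspose (hθ : ‖θ‖ = 1)
    (hv : tsupport (fourierS v) ⊆ Metric.closedBall (0 : Rn n) (1 / 20))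
    (hAs : ContDiff ℝ ∞ A) (hA : ∀ η, A η ≠ 0 → 3 / 4 ≤ ‖η‖ ∧ ‖η‖ ≤ 5 / 4)
    (hA1 : ∀ η, 9 / 10 ≤ ‖η‖ → ‖η‖ ≤ 11 / 10 → A η = 1) (ψ : TestFn n) {m J : ℕ}
    (hJ : ∀ j, J ≤ j → ψ.dilate m (-((2 : ℝ) ^ j • (2 : ℝ) • θ)) = 0) (φ : 𝓢(Rn n, ℂ)) (k : ℕ) :
    wTermDist d θ v k (fourierS (chingTranspose d ((2 : ℝ) • θ) hAs ψ m J φ)) =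
      ((2 * Real.pi : ℝ) : ℂ)⁻¹ ^ n * (ψ.dilate m (-((2 : ℝ) ^ (k + 1) • (2 : ℝ) • θ)) *
        ∫ ζ, fourierS v ζ * (ψ.dilate m (ζ + (2 : ℝ) ^ (k + 1) • θ) *
          fourierS φ ((2 : ℝ) ^ (k + 1) • θ - ζ))) := by
  rw [wTermDist_fourierS, ← integral_const_mul, ← integral_const_mul, ← integral_const_mul]
  refine integral_congr_ae (.of_forall fun ζ => ?_)
  beta_reduce
  by_cases h0 : fourierS v ζ = 0
  · simp only [h0, zero_mul, mul_zero]
  have hζ := norm_le_of_fourierS_ne_zero hv h0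
  obtain ⟨b1, b2⟩ := norm_add_two_pow_smul_bounds hθ hζ (k + 1)
  have hp : (1 : ℝ) ≤ 2 ^ (k + 1) := one_le_pow₀ one_le_two
  have hoff : ∀ j, j ≠ k + 1 → A (((2 : ℝ) ^ j)⁻¹ • (ζ + (2 : ℝ) ^ (k + 1) • θ)) = 0 := by
    intro j hj
    refine apply_inv_two_pow_smul_eq_zero hA ?_
    have hpj : (1 : ℝ) ≤ 2 ^ j := one_le_pow₀ one_le_two
    rcases lt_or_gt_of_ne hj with h | h
    · right
      have h2 : (2 : ℝ) * 2 ^ j ≤ 2 ^ (k + 1) := by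
        rw [← pow_succ']
        exact pow_le_pow_right₀ one_le_two h
      linarith
    · left
      have h2 : (2 : ℝ) * 2 ^ (k + 1) ≤ 2 ^ j := by
        rw [← pow_succ']
        exact pow_le_pow_right₀ one_le_two h
      linarith
  have hone : A (((2 : ℝ) ^ (k + 1))⁻¹ • (ζ + (2 : ℝ) ^ (k + 1) • θ)) = 1 := by
    apply hA1 <;> rw [norm_smul, norm_inv, Real.norm_of_nonneg (by positivity)]
    · rw [le_inv_mul_iff₀ (by positivity)]
      linarith
    · rw [inv_mul_le_iff₀ (by positivity)]
      linarith
  have hcoeff : dyadicCoeff d (k + 1) * dyadicCoeff (-d) (k + 1) = 1 := by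
    rw [dyadicCoeff, dyadicCoeff, ← Complex.ofReal_mul, ← Real.rpow_add two_pos]
    simp
  have harg : (2 : ℝ) ^ (k + 1) • (2 : ℝ) • θ - (ζ + (2 : ℝ) ^ (k + 1) • θ) =
      (2 : ℝ) ^ (k + 1) • θ - ζ := by
    rw [two_smul, smul_add]
    abel
  rw [chingTranspose_apply hAs ψ hJ φ hoff, hone, harg]
  linear_combination (fourierS v ζ * ((2 * Real.pi : ℝ) : ℂ)⁻¹ ^ n *
    ψ.dilate m (-((2 : ℝ) ^ (k + 1) • (2 : ℝ) • θ)) * ψ.dilate m (ζ + (2 : ℝ) ^ (k + 1) • θ) *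
    fourierS φ ((2 : ℝ) ^ (k + 1) • θ - ζ)) * hcoeff

/-- In each term both cut-off factors tend to `1`, and the convolution theorem identifies the limit,
which no longer involves `ψ`. The coefficients have been cancelled, so domination in `k` comes from
the decay of `φ̂`. -/
theorem isLimit_chingSymbol (hθ : ‖θ‖ = 1)
    (hv : tsupport (fourierS v) ⊆ Metric.closedBall (0 : Rn n) (1 / 20))
    (hAs : ContDiff ℝ ∞ A) (hA : ∀ η, A η ≠ 0 → 3 / 4 ≤ ‖η‖ ∧ ‖η‖ ≤ 5 / 4)
    (hA1 : ∀ η, 9 / 10 ≤ ‖η‖ → ‖η‖ ≤ 11 / 10 → A η = 1)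
    (ha : IsSymbol11 d (chingSymbol d ((2 : ℝ) • θ) A)) :
    ha.IsLimit (wDist d θ v) (toDistr (wDist 0 (-θ) v)) := by
  intro ψ hψ
  have hθ0 : θ ≠ 0 := norm_ne_zero_iff.1 (by rw [hθ]; exact one_ne_zero)
  choose J hJ using exists_forall_dilate_eq_zero (smul_ne_zero two_ne_zero hθ0 : (2 : ℝ) • θ ≠ 0) ψ
  refine ⟨fun m => PointwiseConvergenceCLM.precomp ℂ
    (chingTranspose d ((2 : ℝ) • θ) hAs ψ m (J m)) (fourierS' (wDist d θ v)),
    fun m => isOP_chingTranspose ha hAs hA ψ (hJ m) _, fun φ' => ?_⟩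
  set φ := TestFn.toSchwartz φ' with hφ
  have hneg : ‖-θ‖ = 1 := by rw [norm_neg, hθ]
  have h1 : ∀ m, toDistr (PointwiseConvergenceCLM.precomp ℂ
      (chingTranspose d ((2 : ℝ) • θ) hAs ψ m (J m)) (fourierS' (wDist d θ v))) φ' =
      ∑' k, wTermDist d θ v k (fourierS (chingTranspose d ((2 : ℝ) • θ) hAs ψ m (J m) φ)) :=
    fun m => (hasSum_wTermDist_apply d hθ v _).tsum_eq.symm
  -- The two factors `1` hold the places of the cut-offs, whose limits they are.
  have h2 : toDistr (wDist 0 (-θ) v) φ' = ∑' k : ℕ, ((2 * Real.pi : ℝ) : ℂ)⁻¹ ^ n *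
      (1 * ∫ ζ, fourierS v ζ * (1 * fourierS φ ((2 : ℝ) ^ (k + 1) • θ - ζ))) := by
    rw [toDistr_apply, wDist_apply 0 hneg]
    refine tsum_congr fun k => ?_
    simp only [one_mul]
    rw [integral_fourierS_mul_fourierS_sub, smul_neg, neg_neg, dyadicCoeff]
    simp [hφ]
  obtain ⟨B, hB0, hB⟩ := ψ.exists_norm_dilate_le
  set S := SchwartzMap.seminorm ℂ 1 0 (fourierS φ) with hS
  have hS0 : 0 ≤ S := apply_nonneg _ _
  -- On the support of `v̂`, `‖2^{k+1} θ - ζ‖ ≥ 2^{k+1} - 1/20 ≥ 2^k`, so one order of decay already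
  -- gives a geometric bound.
  have hdecay : ∀ (k : ℕ) (ζ : Rn n), fourierS v ζ ≠ 0 →
      ‖fourierS φ ((2 : ℝ) ^ (k + 1) • θ - ζ)‖ ≤ S * ((1 : ℝ) / 2) ^ k := by
    intro k ζ h0
    have hζ := norm_le_of_fourierS_ne_zero hv h0
    have e1 := SchwartzMap.norm_pow_mul_le_seminorm ℂ (fourierS φ) 1 ((2 : ℝ) ^ (k + 1) • θ - ζ)
    have e2 := (norm_add_two_pow_smul_bounds hθ (ζ := -ζ) (by rwa [norm_neg]) (k + 1)).1
    rw [neg_add_eq_sub, pow_succ] at e2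
    have hp : (1 : ℝ) ≤ 2 ^ k := one_le_pow₀ one_le_two
    rw [pow_one] at e1
    rw [one_div, inv_pow, ← div_eq_mul_inv, le_div_iff₀ (by positivity), mul_comm]
    refine le_trans ?_ e1
    gcongr
    rw [pow_succ]
    linarith
  have hbound : ∀ m k ζ, ‖fourierS v ζ * (ψ.dilate m (ζ + (2 : ℝ) ^ (k + 1) • θ) *
      fourierS φ ((2 : ℝ) ^ (k + 1) • θ - ζ))‖ ≤ ‖fourierS v ζ‖ * (B * (S * (1 / 2) ^ k)) := by
    intro m k ζ
    by_cases h0 : fourierS v ζ = 0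
    · simp [h0]
    rw [norm_mul, norm_mul]
    gcongr
    · exact hB _ _
    · exact hdecay k ζ h0
  have hint : ∀ c : ℝ, Integrable fun ζ => ‖fourierS v ζ‖ * c := fun c =>
    (fourierS v).integrable.norm.mul_const c
  simp only [h1, h2, wTermDist_fourierS_chingTranspose hθ hv hAs hA hA1 ψ (hJ _) φ]
  refine tendsto_tsum_of_dominated_convergence
    (bound := fun k : ℕ => ‖((2 * Real.pi : ℝ) : ℂ)⁻¹ ^ n‖ *
      (B * ((∫ ζ, ‖fourierS v ζ‖) * (B * (S * (1 / 2) ^ k))))) ?_ (fun k => ?_)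
    (.of_forall fun m k => ?_)
  · exact ((((summable_geometric_two.mul_left S).mul_left B).mul_left _).mul_left B).mul_left _
  · refine ((tendsto_dilate hψ _).mul ?_).const_mul _
    refine tendsto_integral_of_dominated_convergence
      (fun ζ => ‖fourierS v ζ‖ * (B * (S * (1 / 2) ^ k))) (fun m => ?_) (hint _)
      (fun m => .of_forall (hbound m k)) (.of_forall fun ζ => ?_)
    · have e1 := (fourierS v).continuous
      have e2 := (fourierS φ).continuous
      have e3 := (TestFn.toSchwartz (ψ.dilate m)).continuous
      exact (e1.mul ((e3.comp (continuous_id.add continuous_const)).mul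
        (e2.comp (continuous_const.sub continuous_id)))).aestronglyMeasurable
    · exact ((tendsto_dilate hψ _).mul_const _).const_mul _
  · rw [norm_mul, norm_mul]
    gcongr
    · exact hB _ _
    · rw [← integral_mul_const]
      exact norm_integral_le_of_norm_le (hint _) (.of_forall (hbound m k))

end

/-! ### Disjointness of opposite rays and the conclusion. -/

theorem disjoint_openRay_neg {θ : Rn n} (hθ : θ ≠ 0) : Disjoint (openRay θ) (openRay (-θ)) := by
  rw [Set.disjoint_left]
  rintro _ ⟨t, ht, rfl⟩ ⟨s, hs, h⟩
  rw [smul_neg, eq_neg_iff_add_eq_zero, ← add_smul] at h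
  exact (smul_ne_zero (by linarith) hθ) h

end

theorem mainTheorem12 (n : ℕ) (d : ℝ) (θ : Rn n) (hθ : ‖θ‖ = 1)
    (v : 𝓢(Rn n, ℂ)) (hv0 : v ≠ 0)
    (hv : tsupport (fourierS v) ⊆ Metric.closedBall (0 : Rn n) (1 / 20))
    (A : Rn n → ℂ) (hAs : ContDiff ℝ ∞ A) (hAc : HasCompactSupport A)
    (hA : ∀ η, A η ≠ 0 → 3 / 4 ≤ ‖η‖ ∧ ‖η‖ ≤ 5 / 4)
    (hA1 : ∀ η, 9 / 10 ≤ ‖η‖ → ‖η‖ ≤ 11 / 10 → A η = 1) :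
    Summable (wTermDist d θ v) ∧
    (∀ s : ℝ, MemSobolev s 2 (wDist d θ v) ↔ s < d) ∧
    WF (toDistr (wDist d θ v)) = Set.univ ×ˢ openRay θ ∧
    ∃ ha : IsSymbol11 d (chingSymbol d ((2 : ℝ) • θ) A),
      wDist d θ v ∈ ha.domain ∧
      ha.op (wDist d θ v) = toDistr (wDist 0 (-θ) v) ∧
      WF (ha.op (wDist d θ v)) = Set.univ ×ˢ openRay (-θ) ∧
      Disjoint (WF (toDistr (wDist d θ v))) (WF (ha.op (wDist d θ v))) := by
  have hθ0 : θ ≠ 0 := norm_ne_zero_iff.1 (by rw [hθ]; exact one_ne_zero)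
  have hneg : ‖-θ‖ = 1 := by rw [norm_neg, hθ]
  have ha := isSymbol11_chingSymbol d ((2 : ℝ) • θ) hAs hAc hA
  have hlim := isLimit_chingSymbol hθ hv hAs hA hA1 ha
  have hWF := WF_wDist d hθ hv0 hv
  have hWF' : WF (ha.op (wDist d θ v)) = Set.univ ×ˢ openRay (-θ) := by
    rw [hlim.op_eq]
    exact WF_wDist 0 hneg hv0 hv
  refine ⟨(hasSum_wDist d hθ v).summable, fun s => memSobolev_wDist_iff s d hθ hv0 hv, hWF, ha,
    ⟨_, hlim⟩, hlim.op_eq, hWF', ?_⟩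
  rw [hWF, hWF']
  exact Set.disjoint_prod.2 (.inr (disjoint_openRay_neg hθ0))
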